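/- **Setting.** Let $\Pi=\{p_1,\dots,p_n\}$ be asynchronous processes communicating through an atomic-snapshot memory and running the full-information protocol: a process first writes its input, then alternates between taking a snapshot and writing back its inputs and latest snapshot. A *run* is a finite or infinite sequence of process identifiers giving the order of operations; a process is *participating* in a run if it takes at least one step, and *correct* if it takes infinitely many. A *model* is a set of runs. A *task* is a set of input vectors, a set of output vectors and a total relation $\Delta$ assigning valid output vectors to input vectors (input $\bot$: not participating; output $\bot$: undecided). An algorithm (a decision rule applied to snapshots) *solves* a task in a model $M$ if in every run with input vector $I$ the decided values form a vector $O$ with $(I,O)\in\Delta$, and in every run of $M$ every correct process decides. In $k$-set consensus over $V$ with $|V|\ge k+1$, decided values are inputs and at most $k$ of them are distinct; consensus is the case $k=1$; in *iterative* $k$-set consensus each process goes through a finite or infinite sequence of successive instances with one proposal each, and has to return from each of them if it is correct in a run of the model. Two models are *equivalent* if they solve the same tasks. The *agreement function* of a model $M$ is the function $\alpha:2^\Pi\to\mathbb N$ such that, for each $P\subseteq \Pi$, in the set of runs of $M$ where no process outside $P$ participates, iterative $\alpha(P)$-set consensus can be solved but $(\alpha(P)-1)$-set consensus cannot, with $\alpha(P)=0$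 if $M$ has no infinite run with participating set $P$. The *$\alpha$-model* is the set of runs whose participating set $P$ satisfies $\alpha(P)\ge1$ and in which at most $\alpha(P)-1$ participating processes take only finitely many steps. A model is *characterized by its agreement function* $\alpha$ if it is equivalent to the $\alpha$-model. An *adversary* $\mathcal A$ is a set of subsets of $\Pi$; the *$\mathcal A$-model* is the set of infinite runs whose set of correct processes is in $\mathcal A$. Let $\mathcal A|_P=\{S\in\mathcal A: S\subseteq P\}$ and $\mathcal A|_{P,Q}=\{S\in\mathcal A|_P: S\cap Q\neq\emptyset\}$; let $\mathrm{setcon}(\emptyset)=0$ and $\mathrm{setcon}(\mathcal A)=\max_{S\in\mathcal A}\min_{a\in S}\mathrm{setcon}(\mathcal A|_{S\setminus\{a\}})+1$ for $\mathcal A\ne\emptyset$. $\mathcal A$ is *fair* if $\mathrm{setcon}(\mathcal A|_{P,Q})=\min(|Q|,\mathrm{setcon}(\mathcal A|_P))$ for all $Q\subseteq P\subseteq\Pi$. The *$1$-resilient* adversary consists of all sets of at least $n-1$ processes. **Theorem.** Let $n=3$ and $\mathcal A=\{\{p_1\},\{p_2,p_3\},\{p_1,p_2,p_3\}\}$. For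 a value set $V$ with $|V|\ge2$ let $Cons_{2,3}$ be the task of consensus among $p_2$ and $p_3$: each of $p_2,p_3$ proposes a value of $V$, values decided by $p_2,p_3$ are proposals of $p_2$ or $p_3$, and $p_2,p_3$ do not decide different values (the output of $p_1$ is unconstrained). Then: 1. $\mathrm{setcon}(\mathcal A)=2$ and $\mathrm{setcon}(\mathcal A|_{\Pi,\{p_2,p_3\}})=1$; in particular $\mathcal A$ is not fair. 2. The $\mathcal A$-model has exactly one agreement function $\alpha_{\mathcal A}$, namely $\alpha_{\mathcal A}(P)=\mathrm{setcon}(\mathcal A|_P)$; it equals $0$ for $\emptyset,\{p_2\},\{p_3\}$, equals $2$ for $\{p_1,p_2,p_3\}$, and equals $1$ for all other sets. 3. $Cons_{2,3}$ is solvable in the $\mathcal A$-model. 4. Every task solvable in the $\alpha_{\mathcal A}$-model is solvable in the $1$-resilient model; neither consensus among the three processes nor $Cons_{2,3}$ is solvable in the $1$-resilient model; hence $Cons_{2,3}$ is not solvable in the $\alpha_{\mathcal A}$-model. 5. Hence the $\mathcal A$-model is not equivalent to the $\alpha_{\mathcal A}$-model, and the $\mathcal A$-model is not characterized by its agreement function.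 -/

import Mathlib

/-! ### Runs and models -/

/-- A run of a system of `n` processes: a finite or infinite sequence of process identifiers. -/
abbrev Run (n : ℕ) : Type := Stream'.Seq (Fin n)

/-- A run is infinite if it has a step at every time. -/
def Run.IsInfinite {n : ℕ} (ρ : Run n) : Prop := ∀ t, ∃ p, ρ.get? t = some p

open Classical in
/-- The participating set of a run: the processes that take at least one step. -/
noncomputable def Run.participating {n : ℕ} (ρ : Run n) : Finset (Fin n) :=
  Finset.univ.filter fun p => ∃ t, ρ.get? t = some p

open Classical in
/-- The correct processes of a run: those that take infinitely many steps. -/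
noncomputable def Run.correct {n : ℕ} (ρ : Run n) : Finset (Fin n) :=
  Finset.univ.filter fun p => ∀ t, ∃ s, t ≤ s ∧ ρ.get? s = some p

/-- A model is a set of runs. -/
abbrev Model (n : ℕ) : Type := Set (Run n)

/-- The runs of `M` in which no process outside `P` participates. -/
def Model.restrict {n : ℕ} (M : Model n) (P : Finset (Fin n)) : Model n :=
  {ρ | ρ ∈ M ∧ ρ.participating ⊆ P}

/-! ### The full-information protocol in atomic-snapshot memory -/

/-- The contents of a register: `bot` initially, and afterwards the inputs that its owner has
received so far together with its latest snapshot (all `bot` before its first snapshot). -/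
inductive View (n : ℕ) (V : Type) : Type
  | bot : View n V
  | cell (inputs : List V) (snap : Fin n → View n V) : View n V

/-- An algorithm on top of the full-information protocol is a decision rule: given the process
and the snapshot it has just taken, it may produce an output. -/
abbrev Algorithm (n : ℕ) (V W : Type) : Type := Fin n → (Fin n → View n V) → Option W

/-- A global state: the memory, and for each process its latest snapshot, whether its next
operation is an update (otherwise it is a snapshot), and the outputs it has produced, in order. -/
structure Config (n : ℕ) (V W : Type) : Type where
  mem : Fin n → View n V
  snap : Fin n → Fin n → View n V
  updateNext : Fin n → Bool
  out : Fin n → List W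

/-- The initial global state. -/
def Config.init (n : ℕ) (V W : Type) : Config n V W where
  mem := fun _ => View.bot
  snap := fun _ _ => View.bot
  updateNext := fun _ => true
  out := fun _ => []

/-- One operation of process `p`. The process has a sequence `inp p` of inputs (a single one in
the case of a task), of which it receives the first at the start, and each later one when it has
produced its output for the one before. An update writes the inputs received so far and the latest
snapshot. A snapshot reads the memory, and then `p` applies the decision rule, unless it has
already produced an output for each of its inputs. -/
def Config.step {n : ℕ} {V W : Type} (alg : Algorithm n V W) (inp : Fin n → Stream'.Seq V)
    (c : Config n V W) (p : Fin n) : Config n V W :=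
  if c.updateNext p then
    { c with
      mem := Function.update c.mem p
        (View.cell ((inp p).take ((c.out p).length + 1)) (c.snap p))
      updateNext := Function.update c.updateNext p false }
  else
    { c with
      snap := Function.update c.snap p c.mem
      updateNext := Function.update c.updateNext p true
      out := Function.update c.out p
        (match (inp p).get? (c.out p).length with
          | none => c.out p
          | some _ => c.out p ++ (alg p c.mem).toList) }

/-- The global state after the first `t` steps of the run `ρ` (or at its end, if it is shorter). -/
def exec {n : ℕ} {V W : Type} (alg : Algorithm n V W) (inp : Fin n → Stream'.Seq V)
    (ρ : Run n) : ℕ → Config n V W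
  | 0 => Config.init n V W
  | t + 1 =>
    match ρ.get? t with
    | none => exec alg inp ρ t
    | some p => (exec alg inp ρ t).step alg inp p

/-- In the run `ρ`, process `p` eventually outputs `w` for its input number `j` (from `0`). -/
def Returns {n : ℕ} {V W : Type} (alg : Algorithm n V W) (inp : Fin n → Stream'.Seq V)
    (ρ : Run n) (p : Fin n) (j : ℕ) (w : W) : Prop :=
  ∃ t, ((exec alg inp ρ t).out p)[j]? = some w

/-! ### Tasks and their solvability -/

/-- A task for `n` processes: a set of input vectors, a set of output vectors, and a total relation
that associates with each input vector a set of valid output vectors. The entry `none` stands for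
a process that does not participate (inputs) or is undecided (outputs). -/
structure DistTask (n : ℕ) (V W : Type) : Type where
  inputs : Set (Fin n → Option V)
  outputs : Set (Fin n → Option W)
  rel : (Fin n → Option V) → Set (Fin n → Option W)
  rel_subset : ∀ I ∈ inputs, rel I ⊆ outputs
  rel_total : ∀ I ∈ inputs, (rel I).Nonempty

/-- The one-shot input sequences given by an input vector. -/
def oneShot {n : ℕ} {V : Type} (I : Fin n → Option V) (p : Fin n) : Stream'.Seq V :=
  Stream'.Seq.ofList (I p).toList

/-- The algorithm solves the task `T` in the model `M`: in every run (in `M` or not) with an input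
vector `I` of `T`, the decided values form an output vector valid for `I`; and if the run is in `M`
then every correct process decides. -/
def Solves {n : ℕ} {V W : Type} (alg : Algorithm n V W) (T : DistTask n V W) (M : Model n) : Prop :=
  ∀ I ∈ T.inputs, ∀ ρ : Run n, (∀ p, p ∈ ρ.participating ↔ I p ≠ none) →
    ∃ O ∈ T.rel I, (∀ p w, O p = some w ↔ Returns alg (oneShot I) ρ p 0 w) ∧
      (ρ ∈ M → ∀ p ∈ ρ.correct, O p ≠ none)

/-- The task `T` is solvable in the model `M`. -/
def Solvable {n : ℕ} {V W : Type} (T : DistTask n V W) (M : Model n) : Prop :=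
  ∃ alg : Algorithm n V W, Solves alg T M

/-- `k`-set consensus with values in `V`: the decided values are inputs, and at most `k` of them
are distinct. -/
def setConsensus (n : ℕ) (V : Type) (k : ℕ) : DistTask n V V where
  inputs := Set.univ
  outputs := Set.univ
  rel := fun I => {O | {v | ∃ p, O p = some v} ⊆ {v | ∃ q, I q = some v} ∧
    {v | ∃ p, O p = some v}.encard ≤ k}
  rel_subset := fun _ _ => Set.subset_univ _
  rel_total := fun _ _ => ⟨fun _ => none, by simp⟩

/-- Consensus among the processes in `Q`, with values in `V`: each process in `Q` decides a value
proposed by a process in `Q`, and no two processes in `Q` decide different values. A process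
outside `Q` makes no proposal that counts, and its own output is unconstrained. -/
def consensusAmong {n : ℕ} (V : Type) (Q : Finset (Fin n)) : DistTask n V V where
  inputs := Set.univ
  outputs := Set.univ
  rel := fun I => {O | (∀ p ∈ Q, ∀ v, O p = some v → ∃ q ∈ Q, I q = some v) ∧
    (∀ p ∈ Q, ∀ q ∈ Q, ∀ v w, O p = some v → O q = some w → v = w)}
  rel_subset := fun _ _ => Set.subset_univ _
  rel_total := fun _ _ => ⟨fun _ => none, by simp⟩

/-- In the run `ρ`, process `q` invokes instance `j` with proposal `v`: it has such a proposal and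
has returned from all earlier instances. -/
def Invokes {n : ℕ} {V W : Type} (alg : Algorithm n V W) (inp : Fin n → Stream'.Seq V)
    (ρ : Run n) (q : Fin n) (j : ℕ) (v : V) : Prop :=
  (inp q).get? j = some v ∧ ∀ i < j, ∃ w, Returns alg inp ρ q i w

/-- The algorithm solves iterative `k`-set consensus with values in `V` in the model `M`. Each
participating process goes through a finite or infinite sequence of instances, one after the other,
with a proposal for each. In every run and for every instance, the returned values are proposals
made to this instance, and at most `k` of them are distinct; and in the runs of `M` every correct
process returns from each of its instances. -/
def SolvesIterative {n : ℕ} {V : Type} (alg : Algorithm n V V) (k : ℕ) (M : Model n) : Prop :=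
  ∀ (inp : Fin n → Stream'.Seq V) (ρ : Run n),
    (∀ p, p ∈ ρ.participating ↔ inp p ≠ Stream'.Seq.nil) →
    (∀ j, {v | ∃ p, Returns alg inp ρ p j v} ⊆ {v | ∃ q, Invokes alg inp ρ q j v} ∧
      {v | ∃ p, Returns alg inp ρ p j v}.encard ≤ k) ∧
    (ρ ∈ M → ∀ p ∈ ρ.correct, ∀ j v, (inp p).get? j = some v → ∃ w, Returns alg inp ρ p j w)

/-! ### Agreement functions -/

/-- `α` is the agreement function of the model `M`: among the runs of `M` in which no process
outside `P` participates, iterative `α P`-set consensus can be solved but `(α P - 1)`-set consensus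
cannot; by convention `α P = 0` if `M` has no infinite run with participating set `P`.
The value sets for `k`-set consensus are those with at least `k + 1` elements. (If `M` has such a
run then iterative `0`-set consensus cannot be solved, so the subtraction is a genuine one.) -/
def IsAgreementFunction {n : ℕ} (M : Model n) (α : Finset (Fin n) → ℕ) : Prop :=
  ∀ P : Finset (Fin n),
    ((¬ ∃ ρ ∈ M, ρ.IsInfinite ∧ ρ.participating = P) → α P = 0) ∧
    ((∃ ρ ∈ M, ρ.IsInfinite ∧ ρ.participating = P) →
      (∀ V : Type, (α P : ℕ∞) + 1 ≤ ENat.card V →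
        ∃ alg : Algorithm n V V, SolvesIterative alg (α P) (M.restrict P)) ∧
      (∀ V : Type, ((α P - 1 : ℕ) : ℕ∞) + 1 ≤ ENat.card V →
        ¬ Solvable (setConsensus n V (α P - 1)) (M.restrict P)))

/-- The `α`-model: the runs whose participating set `P` satisfies `α P ≥ 1` and in which at most
`α P - 1` participating processes take only finitely many steps. -/
def alphaModel {n : ℕ} (α : Finset (Fin n) → ℕ) : Model n :=
  {ρ | 1 ≤ α ρ.participating ∧
    (ρ.participating \ ρ.correct).card ≤ α ρ.participating - 1}

/-- Two models are equivalent if they solve the same tasks. -/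
def Model.Equivalent {n : ℕ} (M M' : Model n) : Prop :=
  ∀ (V W : Type) (T : DistTask n V W), Solvable T M ↔ Solvable T M'

/-- A model is characterized by its agreement function `α` if it solves the same tasks as the
`α`-model. -/
def Model.IsCharacterizedByAgreement {n : ℕ} (M : Model n) : Prop :=
  ∃ α, IsAgreementFunction M α ∧ M.Equivalent (alphaModel α)

/-! ### Adversaries -/

/-- An adversary is a set of sets of processes, called live sets. -/
abbrev Adversary (n : ℕ) : Type := Finset (Finset (Fin n))

/-- The adversarial model: the infinite runs whose set of correct processes is a live set. -/
def Adversary.model {n : ℕ} (A : Adversary n) : Model n :=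
  {ρ | ρ.IsInfinite ∧ ρ.correct ∈ A}

/-- `A|_P`: the live sets that are subsets of `P`. -/
def Adversary.restrict {n : ℕ} (A : Adversary n) (P : Finset (Fin n)) : Adversary n :=
  A.filter fun S => S ⊆ P

/-- `A|_{P,Q}`: the live sets that are subsets of `P` and meet `Q`. -/
def Adversary.restrictMeet {n : ℕ} (A : Adversary n) (P Q : Finset (Fin n)) : Adversary n :=
  (A.restrict P).filter fun S => (S ∩ Q).Nonempty

/-- The set consensus power: `setcon ∅ = 0`, and otherwise
`setcon A = max_{S ∈ A} min_{a ∈ S} setcon A|_{S \ {a}} + 1`. -/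
noncomputable def Adversary.setcon {n : ℕ} (A : Adversary n) : ℕ :=
  A.attach.sup fun S =>
    (⨅ a : {a : Fin n // a ∈ S.1}, Adversary.setcon (A.restrict (S.1 \ {a.1}))) + 1
termination_by A.card
decreasing_by
  refine Finset.card_lt_card (Finset.filter_ssubset.2 ⟨S.1, S.2, fun h => ?_⟩)
  have := h a.2
  simp at this

/-- An adversary is fair if `setcon A|_{P,Q} = min(|Q|, setcon A|_P)` for all `Q ⊆ P`. -/
def Adversary.IsFair {n : ℕ} (A : Adversary n) : Prop :=
  ∀ P Q : Finset (Fin n), Q ⊆ P →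
    (A.restrictMeet P Q).setcon = min Q.card (A.restrict P).setcon

/-- The `t`-resilient adversary: all sets of at least `n - t` processes. -/
def resilient (n t : ℕ) : Adversary n :=
  Finset.univ.filter fun S => n ≤ S.card + t

/-- The adversary `{{p₁}, {p₂, p₃}, {p₁, p₂, p₃}}`, where `p₁, p₂, p₃` are `0, 1, 2 : Fin 3`. -/
def exampleAdversary : Adversary 3 := {{0}, {1, 2}, {0, 1, 2}}

/-- The function `P ↦ setcon A|_P` for the adversary `A = {{p₁}, {p₂, p₃}, {p₁, p₂, p₃}}`. -/
noncomputable def exampleAlpha (P : Finset (Fin 3)) : ℕ := (exampleAdversary.restrict P).setcon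

/-!
The `A`-model and the `α_A`-model are separated by consensus between `p₂` and `p₃`, the processes
`1` and `2` of the formalization.

*Possibility.* In the `A`-model, `p₂` is correct whenever `p₃` is. So `p₂` can act as a leader that
returns its own proposals, and `p₃` can wait for them; `p₁` returns its own proposals. This solves
consensus between `p₂` and `p₃`, and it solves iterative `2`-set consensus among all three. The
iterative problem has one difficulty: the leader may have fewer instances than its follower. Since
the leader returns from an instance at its first snapshot after writing the proposal, its register
shows when it has no instances left (`followLeader`), and the follower then returns its own
proposal. If only some of the processes participate, a subset of them is allowed to return, and one
value per instance is enough. The properties of the algorithm are `leaderAlg_safe` and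
`leaderAlg_live`.

*Impossibility.* All negative results, except for the trivial ones on `0`-set consensus, are
instances of `not_solvable_of_crash`: there is no agreement among the processes of a set `Q` in a
model which contains all the runs where everybody is correct and in which, for each process `x`, a
fixed set of processes that meets `Q` and avoids `x` may be the set of correct processes. This is the bivalence
argument of Fischer, Lynch and Paterson. Some initial state is bivalent, because changing a single
proposal goes unnoticed if its owner takes no step. From a bivalent state each process can be made
to take a step into a bivalent state, because the two orders of two operations can be distinguished
by at most one process (`exists_agreeExcept_swap`), and the others decide without it. Hence there is
a run with all processes correct and without a decision. The criterion applies to the `A`-model,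
where either `{p₁}` or `{p₂, p₃}` avoids a given process, and to the `1`-resilient model.

*Agreement function.* `k`-set consensus gets easier as `k` grows, so the number `α P` is determined
by the possibility and impossibility results for `P`. In a `1`-resilient run either all processes
participate and at most one of them crashes, where `α_A P = 2`, or two processes participate and
none of them crashes, where `α_A P = 1`. So the `1`-resilient model is a subset of the `α_A`-model,
and unsolvability passes from the former to the latter.
-/

/-! ### Steps and executions -/

section Executions

variable {n : ℕ} {V W : Type}

/-- The global state after the steps of the finite schedule `s`, started from `c`. -/
def Config.run (alg : Algorithm n V W) (inp : Fin n → Stream'.Seq V) (c : Config n V W)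
    (s : List (Fin n)) : Config n V W :=
  s.foldl (Config.step alg inp) c

variable {alg : Algorithm n V W} {inp : Fin n → Stream'.Seq V} {c : Config n V W}

@[simp] lemma Config.run_nil : c.run alg inp [] = c := rfl

@[simp] lemma Config.run_cons (p : Fin n) (s : List (Fin n)) :
    c.run alg inp (p :: s) = (c.step alg inp p).run alg inp s := rfl

lemma Config.run_append (s u : List (Fin n)) :
    c.run alg inp (s ++ u) = (c.run alg inp s).run alg inp u :=
  List.foldl_append

lemma exec_ofStream (g : Stream' (Fin n)) (t : ℕ) :
    exec alg inp (Stream'.Seq.ofStream g) t = (Config.init n V W).run alg inp (g.take t) := by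
  induction t with
  | zero => rfl
  | succ t ih =>
    rw [Stream'.take_succ', Config.run_append, ← ih]
    rfl

lemma Config.step_update {p : Fin n} (h : c.updateNext p = true) :
    c.step alg inp p =
      { c with
        mem := Function.update c.mem p
          (View.cell ((inp p).take ((c.out p).length + 1)) (c.snap p))
        updateNext := Function.update c.updateNext p false } := by
  rw [Config.step, if_pos h]

lemma Config.step_snapshot {p : Fin n} (h : c.updateNext p = false) :
    c.step alg inp p =
      { c with
        snap := Function.update c.snap p c.mem
        updateNext := Function.update c.updateNext p true
        out := Function.update c.out p
          (match (inp p).get? (c.out p).length with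
            | none => c.out p
            | some _ => c.out p ++ (alg p c.mem).toList) } := by
  refine (if_neg (by simp [h])).trans ?_
  cases (inp p).get? (c.out p).length <;> rfl

lemma Config.out_prefix_step (p q : Fin n) : c.out q <+: (c.step alg inp p).out q := by
  cases h : c.updateNext p with
  | true => simp [Config.step_update h]
  | false =>
    rw [Config.step_snapshot h]
    obtain rfl | hq := eq_or_ne q p
    · simp only [Function.update_self]
      split <;> simp
    · simp [hq]

lemma Config.out_prefix_run (s : List (Fin n)) (q : Fin n) :
    c.out q <+: (c.run alg inp s).out q := by
  induction s generalizing c with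
  | nil => simp
  | cons p s ih => exact (Config.out_prefix_step p q).trans ih

lemma exec_out_prefix (ρ : Run n) (q : Fin n) {t t' : ℕ} (h : t ≤ t') :
    (exec alg inp ρ t).out q <+: (exec alg inp ρ t').out q := by
  induction t', h using Nat.le_induction with
  | base => simp
  | succ t' _ ih =>
    refine ih.trans ?_
    rw [exec]
    cases ρ.get? t' with
    | none => simp
    | some p => exact Config.out_prefix_step p q

lemma getElem?_of_prefix {l l' : List W} (h : l <+: l') {j : ℕ} {w : W} (hj : l[j]? = some w) :
    l'[j]? = some w := by
  obtain ⟨m, rfl⟩ := h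
  rw [List.getElem?_append_left (List.getElem?_eq_some_iff.1 hj).1, hj]

lemma Returns.unique {ρ : Run n} {p : Fin n} {j : ℕ} {v w : W}
    (hv : Returns alg inp ρ p j v) (hw : Returns alg inp ρ p j w) : v = w := by
  obtain ⟨t, ht⟩ := hv
  obtain ⟨t', ht'⟩ := hw
  have h1 := getElem?_of_prefix (exec_out_prefix ρ p (le_max_left t t')) ht
  have h2 := getElem?_of_prefix (exec_out_prefix ρ p (le_max_right t t')) ht'
  simpa using h1.symm.trans h2

lemma Config.step_congr {inp' : Fin n → Stream'.Seq V} {p : Fin n} (h : inp p = inp' p) :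
    c.step alg inp p = c.step alg inp' p := by
  simp only [Config.step, h]

/-- The inputs of processes that take no steps have no influence. -/
lemma exec_congr {inp' : Fin n → Stream'.Seq V} {ρ : Run n}
    (h : ∀ p ∈ ρ.participating, inp p = inp' p) (t : ℕ) :
    exec alg inp ρ t = exec alg inp' ρ t := by
  induction t with
  | zero => rfl
  | succ t ih =>
    rw [exec, exec, ih]
    cases hp : ρ.get? t with
    | none => rfl
    | some p => exact Config.step_congr (h p (by simpa [Run.participating] using ⟨t, hp⟩))

end Executions

/-! ### Indistinguishability -/

section Indistinguishability

variable {n : ℕ} {V W : Type} {alg : Algorithm n V W} {inp inp' : Fin n → Stream'.Seq V}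

/-- Two global states that differ at most in the local state of `x`: no other process can tell
them apart as long as `x` takes no step. -/
structure AgreeExcept (x : Fin n) (c c' : Config n V W) : Prop where
  mem : c.mem = c'.mem
  snap : ∀ p ≠ x, c.snap p = c'.snap p
  updateNext : ∀ p ≠ x, c.updateNext p = c'.updateNext p
  out : ∀ p ≠ x, c.out p = c'.out p

lemma AgreeExcept.refl (x : Fin n) (c : Config n V W) : AgreeExcept x c c :=
  ⟨rfl, fun _ _ => rfl, fun _ _ => rfl, fun _ _ => rfl⟩

lemma AgreeExcept.step {x : Fin n} {c c' : Config n V W} (h : AgreeExcept x c c')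
    (hinp : ∀ p ≠ x, inp p = inp' p) {p : Fin n} (hp : p ≠ x) :
    AgreeExcept x (c.step alg inp p) (c'.step alg inp' p) := by
  have hu := h.updateNext p hp
  cases hc : c.updateNext p with
  | true =>
    rw [Config.step_update hc, Config.step_update (hu ▸ hc)]
    refine ⟨?_, h.snap, fun q hq => ?_, h.out⟩
    · simp only [h.mem, h.snap p hp, h.out p hp, hinp p hp]
    · simp only [Function.update_apply, h.updateNext q hq]
  | false =>
    rw [Config.step_snapshot hc, Config.step_snapshot (hu ▸ hc)]
    refine ⟨h.mem, fun q hq => ?_, fun q hq => ?_, fun q hq => ?_⟩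
    · simp only [Function.update_apply, h.mem, h.snap q hq]
    · simp only [Function.update_apply, h.updateNext q hq]
    · simp only [Function.update_apply, h.mem, h.out q hq, h.out p hp, hinp p hp]

lemma AgreeExcept.run {x : Fin n} {c c' : Config n V W} (h : AgreeExcept x c c')
    (hinp : ∀ p ≠ x, inp p = inp' p) {s : List (Fin n)} (hs : x ∉ s) :
    AgreeExcept x (c.run alg inp s) (c'.run alg inp' s) := by
  induction s generalizing c c' with
  | nil => exact h
  | cons p s ih =>
    rw [List.mem_cons, not_or] at hs
    exact ih (h.step hinp (Ne.symm hs.1)) hs.2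

/-- The operations of two processes `p` and `q` either commute, or one of them is an update and
the other a snapshot, and then their order is visible only in the local state of the process that
takes the snapshot. -/
lemma exists_agreeExcept_swap (alg : Algorithm n V W) (inp : Fin n → Stream'.Seq V)
    (c : Config n V W) {p q : Fin n} (hpq : p ≠ q) :
    ∃ (e : List (Fin n)) (x : Fin n),
      AgreeExcept x ((c.step alg inp p).run alg inp e) ((c.step alg inp q).step alg inp p) := by
  cases hp : c.updateNext p <;> cases hq : c.updateNext q
  · refine ⟨[q], p, ?_⟩
    rw [Config.step_snapshot hp, Config.step_snapshot hq, Config.run_cons,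
      Config.step_snapshot (by simpa [hpq.symm] using hq),
      Config.step_snapshot (by simpa [hpq] using hp)]
    simp only [Config.run_nil, Function.update_comm hpq, Function.update_of_ne hpq,
      Function.update_of_ne hpq.symm]
    exact AgreeExcept.refl _ _
  · refine ⟨[q], p, ?_⟩
    rw [Config.step_snapshot hp, Config.step_update hq, Config.run_cons,
      Config.step_update (by simpa [hpq.symm] using hq),
      Config.step_snapshot (by simpa [hpq] using hp)]
    constructor <;> simp +contextual [hpq.symm, Function.update_apply]
  · refine ⟨[], q, ?_⟩
    rw [Config.step_update hp, Config.step_snapshot hq,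
      Config.step_update (by simpa [hpq] using hp)]
    constructor <;> simp +contextual [hpq, Function.update_apply]
  · refine ⟨[q], p, ?_⟩
    rw [Config.step_update hp, Config.step_update hq, Config.run_cons,
      Config.step_update (by simpa [hpq.symm] using hq),
      Config.step_update (by simpa [hpq] using hp)]
    simp only [Config.run_nil, Function.update_comm hpq]
    exact AgreeExcept.refl _ _

end Indistinguishability

/-! ### Infinite runs with a prescribed set of correct processes -/

section InfiniteRuns

variable {n : ℕ}

lemma get_append_of_length_le {s : List (Fin n)} {g : Stream' (Fin n)} {t : ℕ}
    (h : s.length ≤ t) : (s ++ₛ g).get t = g.get (t - s.length) := by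
  obtain ⟨k, rfl⟩ := Nat.exists_eq_add_of_le h
  rw [Stream'.get_append_right, Nat.add_sub_cancel_left]

lemma take_length_append (s : List (Fin n)) (g : Stream' (Fin n)) :
    (s ++ₛ g).take s.length = s := by
  simpa using (Stream'.append_take (x := s) (a := g) (n := 0)).symm

lemma isInfinite_ofStream (g : Stream' (Fin n)) : Run.IsInfinite (Stream'.Seq.ofStream g) :=
  fun t => ⟨g.get t, rfl⟩

lemma mem_participating {ρ : Run n} {p : Fin n} :
    p ∈ ρ.participating ↔ ∃ t, ρ.get? t = some p := by
  simp [Run.participating]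

lemma mem_correct {ρ : Run n} {p : Fin n} :
    p ∈ ρ.correct ↔ ∀ t, ∃ s, t ≤ s ∧ ρ.get? s = some p := by
  simp [Run.correct]

lemma correct_subset_participating (ρ : Run n) : ρ.correct ⊆ ρ.participating := by
  intro p hp
  obtain ⟨s, -, hs⟩ := mem_correct.1 hp 0
  exact mem_participating.2 ⟨s, hs⟩

lemma mem_participating_ofStream {g : Stream' (Fin n)} {p : Fin n} :
    p ∈ Run.participating (Stream'.Seq.ofStream g) ↔ ∃ t, g.get t = p := by
  rw [mem_participating]
  exact exists_congr fun t => Option.some_inj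

lemma mem_correct_ofStream {g : Stream' (Fin n)} {p : Fin n} :
    p ∈ Run.correct (Stream'.Seq.ofStream g) ↔ ∀ t, ∃ s, t ≤ s ∧ g.get s = p := by
  rw [mem_correct]
  exact forall_congr' fun t => exists_congr fun s => and_congr_right fun _ => Option.some_inj

/-- A sequence that visits each element of a nonempty set infinitely often, and nothing else. -/
lemma exists_stream_visiting {S : Finset (Fin n)} (hS : S.Nonempty) :
    ∃ g : Stream' (Fin n), (∀ t, g.get t ∈ S) ∧ ∀ p ∈ S, ∀ t, ∃ s, t ≤ s ∧ g.get s = p := by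
  obtain ⟨p₀, hp₀⟩ := hS
  have : NeZero n := ⟨by rintro rfl; exact p₀.elim0⟩
  refine ⟨fun t => if Fin.ofNat n t ∈ S then Fin.ofNat n t else p₀, fun t => ?_, fun p hp t => ?_⟩
  · change (if Fin.ofNat n t ∈ S then Fin.ofNat n t else p₀) ∈ S
    split_ifs with h
    exacts [h, hp₀]
  · have hmod : Fin.ofNat n (p + n * t) = p := by
      ext
      simp [Nat.mod_eq_of_lt p.2]
    refine ⟨p + n * t, ?_, ?_⟩
    · nlinarith [Nat.pos_of_neZero n]
    · change (if Fin.ofNat n (p + n * t) ∈ S then Fin.ofNat n (p + n * t) else p₀) = p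
      rw [hmod, if_pos hp]

lemma correct_ofStream_append {S : Finset (Fin n)} {g : Stream' (Fin n)} (hg : ∀ t, g.get t ∈ S)
    (hg' : ∀ p ∈ S, ∀ t, ∃ s, t ≤ s ∧ g.get s = p) (s : List (Fin n)) :
    Run.correct (Stream'.Seq.ofStream (s ++ₛ g)) = S := by
  ext p
  rw [mem_correct_ofStream]
  constructor
  · intro h
    obtain ⟨t, ht, rfl⟩ := h s.length
    rw [get_append_of_length_le ht]
    exact hg _
  · intro hp t
    obtain ⟨t', ht', h⟩ := hg' p hp t
    exact ⟨s.length + t', by lia, by rwa [Stream'.get_append_right]⟩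

lemma participating_ofStream_append {S : Finset (Fin n)} {g : Stream' (Fin n)}
    (hg : ∀ t, g.get t ∈ S) (hg' : ∀ p ∈ S, ∀ t, ∃ s, t ≤ s ∧ g.get s = p) (s : List (Fin n)) :
    Run.participating (Stream'.Seq.ofStream (s ++ₛ g)) = s.toFinset ∪ S := by
  ext p
  rw [mem_participating_ofStream, Finset.mem_union, List.mem_toFinset]
  constructor
  · rintro ⟨t, rfl⟩
    rcases lt_or_ge t s.length with ht | ht
    · rw [Stream'.get_append_left _ _ _ ht]
      exact Or.inl (List.getElem_mem ht)
    · rw [get_append_of_length_le ht]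
      exact Or.inr (hg _)
  · rintro (hp | hp)
    · obtain ⟨i, hi, rfl⟩ := List.getElem_of_mem hp
      exact ⟨i, Stream'.get_append_left _ _ _ hi⟩
    · obtain ⟨t, -, h⟩ := hg' p hp 0
      exact ⟨s.length + t, by rwa [Stream'.get_append_right]⟩

lemma exists_infinite_run {S P : Finset (Fin n)} (hS : S.Nonempty) (hSP : S ⊆ P) :
    ∃ ρ : Run n, ρ.IsInfinite ∧ ρ.correct = S ∧ ρ.participating = P := by
  obtain ⟨g, hg, hg'⟩ := exists_stream_visiting hS
  refine ⟨Stream'.Seq.ofStream (P.toList ++ₛ g), isInfinite_ofStream _,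
    correct_ofStream_append hg hg' _, ?_⟩
  rw [participating_ofStream_append hg hg', Finset.toList_toFinset, Finset.union_eq_left.2 hSP]

/-- A chain of finite schedules that grows beyond all bounds has a limit. -/
lemma exists_stream_limit {s : ℕ → List (Fin n)} (hs : ∀ k, s k <+: s (k + 1))
    (hlen : ∀ k, k ≤ (s k).length) :
    ∃ g : Stream' (Fin n), ∀ k, g.take (s k).length = s k := by
  have hmono : ∀ {k m}, k ≤ m → s k <+: s m := fun h =>
    Nat.le_induction (List.prefix_refl _) (fun m _ ih => ih.trans (hs m)) _ h
  have hget : ∀ t, t < (s (t + 1)).length := fun t => hlen (t + 1)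
  obtain ⟨g, hg⟩ : ∃ g : Stream' (Fin n), ∀ t, g.get t = (s (t + 1))[t]'(hget t) :=
    ⟨fun t => (s (t + 1))[t]'(hget t), fun _ => rfl⟩
  refine ⟨g, fun k => List.ext_getElem? fun t => ?_⟩
  rcases lt_or_ge t (s k).length with ht | ht
  · rw [Stream'.getElem?_take ht, List.getElem?_eq_getElem ht, hg]
    have h1 := getElem?_of_prefix (hmono (le_max_left k (t + 1))) (List.getElem?_eq_getElem ht)
    have h2 := getElem?_of_prefix (hmono (le_max_right k (t + 1)))
      (List.getElem?_eq_getElem (hget t))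
    simpa using h2.symm.trans h1
  · rw [List.getElem?_eq_none (by simpa using ht), List.getElem?_eq_none ht]

end InfiniteRuns

/-! ### Consensus is impossible if any one process may crash -/

section Impossibility

variable {n : ℕ} {V W : Type}

/-- Every process `p` proposes `x p`. -/
def proposals (x : Fin n → V) : Fin n → Stream'.Seq V := oneShot fun p => some (x p)

/-- Some process of `Q` has produced the output `v` in the global state `c`. -/
def Decided (Q : Finset (Fin n)) (c : Config n V W) (v : W) : Prop :=
  ∃ p ∈ Q, (c.out p)[0]? = some v

/-- The output `v` can still be produced by some process of `Q` when the run is continued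
from `c`. -/
def CanDecide (alg : Algorithm n V W) (inp : Fin n → Stream'.Seq V) (Q : Finset (Fin n))
    (c : Config n V W) (v : W) : Prop :=
  ∃ s, Decided Q (c.run alg inp s) v

/-- Two different outputs of the processes of `Q` are still possible when the run is continued
from `c`. -/
def Bivalent (alg : Algorithm n V W) (inp : Fin n → Stream'.Seq V) (Q : Finset (Fin n))
    (c : Config n V W) : Prop :=
  ∃ v w, v ≠ w ∧ CanDecide alg inp Q c v ∧ CanDecide alg inp Q c w

variable {alg : Algorithm n V W} {inp inp' : Fin n → Stream'.Seq V} {Q : Finset (Fin n)}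
  {c : Config n V W}

lemma Decided.run {v : W} (h : Decided Q c v) (s : List (Fin n)) :
    Decided Q (c.run alg inp s) v := by
  obtain ⟨p, hp, h⟩ := h
  exact ⟨p, hp, getElem?_of_prefix (Config.out_prefix_run s p) h⟩

lemma CanDecide.of_run {s : List (Fin n)} {v : W} (h : CanDecide alg inp Q (c.run alg inp s) v) :
    CanDecide alg inp Q c v := by
  obtain ⟨u, hu⟩ := h
  exact ⟨s ++ u, by rwa [Config.run_append]⟩

/-- What a solution of the agreement problem among the processes of `Q` guarantees in every
reachable global state: whichever process `x` crashes, the other processes can go on until one of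
them that belongs to `Q` has an output; and the outputs of the processes of `Q` agree. -/
structure Robust (alg : Algorithm n V W) (inp : Fin n → Stream'.Seq V) (Q : Finset (Fin n)) :
    Prop where
  decide_without : ∀ (s : List (Fin n)) (x : Fin n), ∃ u, x ∉ u ∧ ∃ p ∈ Q, p ≠ x ∧ ∃ v,
    (((Config.init n V W).run alg inp (s ++ u)).out p)[0]? = some v
  agree : ∀ (s : List (Fin n)) (v w : W), Decided Q ((Config.init n V W).run alg inp s) v →
    Decided Q ((Config.init n V W).run alg inp s) w → v = w

/-- Two states that differ only in the local state of one process have a possible output in common: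
the other processes decide without noticing the difference. The inputs of that process may differ
as well. -/
lemma Robust.exists_common (h : Robust alg inp Q) {s : List (Fin n)} {c' : Config n V W}
    {x : Fin n} (hc : AgreeExcept x ((Config.init n V W).run alg inp s) c')
    (hinp : ∀ p ≠ x, inp p = inp' p) :
    ∃ v, CanDecide alg inp Q ((Config.init n V W).run alg inp s) v ∧
      CanDecide alg inp' Q c' v := by
  obtain ⟨u, hxu, p, hp, hpx, v, hv⟩ := h.decide_without s x
  rw [Config.run_append] at hv
  refine ⟨v, ⟨u, p, hp, hv⟩, u, p, hp, ?_⟩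
  rw [← (hc.run hinp hxu).out p hpx, hv]

/-- From a bivalent state, every process `p` can take a step at some later time such that the
state is still bivalent. -/
lemma Robust.exists_bivalent_step (h : Robust alg inp Q) {s : List (Fin n)}
    (hs : Bivalent alg inp Q ((Config.init n V W).run alg inp s)) (p : Fin n) :
    ∃ u, Bivalent alg inp Q ((Config.init n V W).run alg inp (s ++ u ++ [p])) := by
  by_contra hno
  -- otherwise only one output is possible after each such step of `p`
  have huni : ∀ u v w,
      CanDecide alg inp Q ((Config.init n V W).run alg inp (s ++ u ++ [p])) v →
      CanDecide alg inp Q ((Config.init n V W).run alg inp (s ++ u ++ [p])) w → v = w := by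
    intro u v w hv hw
    by_contra hvw
    exact hno ⟨u, v, w, hvw, hv, hw⟩
  obtain ⟨v, hv, -⟩ := h.exists_common (s := s ++ [] ++ [p]) (AgreeExcept.refl p _)
    (inp' := inp) fun _ _ => rfl
  -- and it remains the same when `p` takes its step later
  have hall : ∀ u, CanDecide alg inp Q ((Config.init n V W).run alg inp (s ++ u ++ [p])) v := by
    intro u
    induction u using List.reverseRecOn with
    | nil => exact hv
    | append_singleton u q ih =>
      obtain rfl | hpq := eq_or_ne p q
      · obtain ⟨w, hw, -⟩ := h.exists_common (s := s ++ (u ++ [p]) ++ [p]) (AgreeExcept.refl p _)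
          (inp' := inp) fun _ _ => rfl
        have hw' : CanDecide alg inp Q ((Config.init n V W).run alg inp (s ++ u ++ [p])) w := by
          rw [← List.append_assoc, Config.run_append] at hw
          exact hw.of_run
        rwa [huni u v w ih hw']
      · obtain ⟨e, x, hx⟩ := exists_agreeExcept_swap alg inp
          ((Config.init n V W).run alg inp (s ++ u)) hpq
        have hx' : AgreeExcept x ((Config.init n V W).run alg inp (s ++ u ++ [p] ++ e))
            ((Config.init n V W).run alg inp (s ++ (u ++ [q]) ++ [p])) := by
          simpa [Config.run_append] using hx
        obtain ⟨w, hw, hw'⟩ := h.exists_common hx' (inp' := inp) fun _ _ => rfl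
        rw [Config.run_append] at hw
        rwa [huni u v w ih hw.of_run]
  obtain ⟨w, hvw, u, hu⟩ : ∃ w, v ≠ w ∧ CanDecide alg inp Q
      ((Config.init n V W).run alg inp s) w := by
    obtain ⟨a, b, hab, ha, hb⟩ := hs
    by_cases hva : v = a
    · exact ⟨b, hva ▸ hab, hb⟩
    · exact ⟨a, hva, ha⟩
  refine hvw (huni u v w (hall u) ⟨[], ?_⟩)
  rw [← Config.run_append] at hu
  rw [← Config.run_append, List.append_nil, Config.run_append]
  exact hu.run [p]

/-- If a bivalent state is reachable, then there is a run in which every process is correct and in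
which no process of `Q` ever decides. -/
lemma Robust.exists_undecided [NeZero n] (h : Robust alg inp Q)
    (hs : Bivalent alg inp Q (Config.init n V W)) :
    ∃ g : Stream' (Fin n), Run.correct (Stream'.Seq.ofStream g) = Finset.univ ∧
      ∀ p ∈ Q, ∀ v, ¬ Returns alg inp (Stream'.Seq.ofStream g) p 0 v := by
  choose! u hu using fun s hs p => h.exists_bivalent_step (s := s) hs p
  -- the processes take their steps in turn, with enough steps in between to stay bivalent
  let s : ℕ → List (Fin n) := fun k =>
    Nat.rec [] (fun k s => s ++ u s (Fin.ofNat n k) ++ [Fin.ofNat n k]) k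
  have hsucc : ∀ k, s (k + 1) = s k ++ u (s k) (Fin.ofNat n k) ++ [Fin.ofNat n k] := fun _ => rfl
  have hbiv : ∀ k, Bivalent alg inp Q ((Config.init n V W).run alg inp (s k)) := by
    intro k
    induction k with
    | zero => exact hs
    | succ k ih => exact hu _ ih _
  have hlen : ∀ k, k ≤ (s k).length := by
    intro k
    induction k with
    | zero => exact Nat.zero_le _
    | succ k ih =>
      rw [hsucc]
      simp only [List.length_append, List.length_singleton]
      lia
  obtain ⟨g, hg⟩ := exists_stream_limit (s := s)
    (fun k => by rw [hsucc, List.append_assoc]; exact List.prefix_append _ _) hlen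
  refine ⟨g, ?_, ?_⟩
  · ext p
    simp only [mem_correct_ofStream, Finset.mem_univ, iff_true]
    intro t
    have hmod : Fin.ofNat n (p + n * t) = p := by
      ext
      simp [Nat.mod_eq_of_lt p.2]
    have hk := hsucc (p + n * t)
    rw [hmod] at hk
    have hk' := hg (p + n * t + 1)
    refine ⟨(s (p + n * t) ++ u (s (p + n * t)) p).length, ?_, ?_⟩
    · have := hlen (p + n * t)
      rw [List.length_append]
      nlinarith [Nat.pos_of_neZero n]
    · have hlt : (s (p + n * t) ++ u (s (p + n * t)) p).length < (s (p + n * t + 1)).length := by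
        rw [hk, List.length_append (bs := [p])]
        simp
      have := Stream'.getElem?_take (s := g) hlt
      rw [hk', hk, List.getElem?_append_right le_rfl] at this
      simpa using this.symm
  · rintro p hp v ⟨t, ht⟩
    have hd : Decided Q ((Config.init n V W).run alg inp (s t)) v := by
      refine ⟨p, hp, ?_⟩
      rw [← hg t, ← exec_ofStream]
      exact getElem?_of_prefix (exec_out_prefix _ p (hlen t)) ht
    obtain ⟨a, b, hab, ⟨ua, ha⟩, ⟨ub, hb⟩⟩ := hbiv t
    rw [← Config.run_append] at ha hb
    refine hab ((h.agree _ a v ha ?_).trans (h.agree _ v b ?_ hb))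
    · rw [Config.run_append]; exact hd.run _
    · rw [Config.run_append]; exact hd.run _

open Classical in
/-- A solution applies to runs in which only some of the processes participate: those that do not
are taken to have no input. -/
lemma Solves.restrict {T : DistTask n V W} {M : Model n} (hT : T.inputs = Set.univ)
    (h : Solves alg T M) (x : Fin n → V) (ρ : Run n) :
    ∃ O ∈ T.rel (fun p => if p ∈ ρ.participating then some (x p) else none),
      (∀ p w, O p = some w ↔ Returns alg (proposals x) ρ p 0 w) ∧
      (ρ ∈ M → ∀ p ∈ ρ.correct, O p ≠ none) := by
  obtain ⟨O, hO, hret, hdec⟩ := h (fun p => if p ∈ ρ.participating then some (x p) else none)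
    (hT ▸ Set.mem_univ _) ρ (fun p => by simp)
  refine ⟨O, hO, fun p w => ?_, hdec⟩
  rw [hret]
  refine exists_congr fun t => ?_
  rw [exec_congr (inp' := proposals x) fun p hp => ?_]
  simp [proposals, oneShot, hp]

/-- Agreement on a proposed value among the processes of `Q` is impossible in a model that contains
all the runs where everybody is correct and, for each process `x`, all the infinite runs with a
certain set of correct processes that meets `Q` and does not contain `x`. -/
theorem not_solvable_of_crash [NeZero n] [Nontrivial V] {T : DistTask n V V} {M : Model n}
    (hT : T.inputs = Set.univ)
    (hagree : ∀ I, ∀ O ∈ T.rel I, ∀ p ∈ Q, ∀ q ∈ Q, ∀ v w, O p = some v → O q = some w → v = w)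
    (hvalid : ∀ I, ∀ O ∈ T.rel I, ∀ p ∈ Q, ∀ w, O p = some w → ∃ q, I q = some w)
    (hcrash : ∀ x, ∃ S : Finset (Fin n), x ∉ S ∧ (∃ p ∈ Q, p ∈ S) ∧
      ∀ ρ : Run n, ρ.IsInfinite → ρ.correct = S → ρ ∈ M)
    (hall : ∀ ρ : Run n, ρ.IsInfinite → ρ.correct = Finset.univ → ρ ∈ M) :
    ¬ Solvable T M := by
  rintro ⟨alg, hsol⟩
  have hrob : ∀ x : Fin n → V, Robust alg (proposals x) Q := by
    refine fun x => ⟨fun s y => ?_, ?_⟩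
    · obtain ⟨S, hyS, ⟨p, hpQ, hpS⟩, hM⟩ := hcrash y
      obtain ⟨g, hg, hg'⟩ := exists_stream_visiting ⟨p, hpS⟩
      have hcor := correct_ofStream_append hg hg' s
      obtain ⟨O, -, hret, hdec⟩ := hsol.restrict hT x (Stream'.Seq.ofStream (s ++ₛ g))
      obtain ⟨v, hv⟩ := Option.ne_none_iff_exists'.1
        (hdec (hM _ (isInfinite_ofStream _) hcor) p (hcor ▸ hpS))
      obtain ⟨t, ht⟩ := (hret p v).1 hv
      refine ⟨g.take t, fun hy => ?_, p, hpQ, fun h => hyS (h ▸ hpS), v, ?_⟩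
      · obtain ⟨i, hi, rfl⟩ := List.getElem_of_mem hy
        rw [Stream'.take_get] at hyS
        exact hyS (hg i)
      · rw [Stream'.append_take, ← exec_ofStream]
        exact getElem?_of_prefix (exec_out_prefix _ p (Nat.le_add_left _ _)) ht
    · rintro s v w ⟨p, hp, hv⟩ ⟨q, hq, hw⟩
      obtain ⟨O, hO, hret, -⟩ := hsol.restrict hT x
        (Stream'.Seq.ofStream (s ++ₛ Stream'.const p))
      have hex : exec alg (proposals x) (Stream'.Seq.ofStream (s ++ₛ Stream'.const p)) s.length =
          (Config.init n V V).run alg (proposals x) s := by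
        rw [exec_ofStream, take_length_append]
      exact hagree _ O hO p hp q hq v w ((hret p v).2 ⟨s.length, hex ▸ hv⟩)
        ((hret q w).2 ⟨s.length, hex ▸ hw⟩)
  have hbiv : ∀ x : Fin n → V, ¬ Bivalent alg (proposals x) Q (Config.init n V V) := by
    intro x hx
    obtain ⟨g, hcor, hund⟩ := (hrob x).exists_undecided hx
    obtain ⟨S, -, ⟨p, hpQ, -⟩, -⟩ := hcrash 0
    obtain ⟨O, -, hret, hdec⟩ := hsol.restrict hT x (Stream'.Seq.ofStream g)
    obtain ⟨v, hv⟩ := Option.ne_none_iff_exists'.1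
      (hdec (hall _ (isInfinite_ofStream _) hcor) p (hcor ▸ Finset.mem_univ p))
    exact hund p hpQ v ((hret p v).1 hv)
  have huni : ∀ (x : Fin n → V) v w, CanDecide alg (proposals x) Q (Config.init n V V) v →
      CanDecide alg (proposals x) Q (Config.init n V V) w → v = w := by
    intro x v w hv hw
    by_contra hvw
    exact hbiv x ⟨v, w, hvw, hv, hw⟩
  have hconst : ∀ a w, CanDecide alg (proposals fun _ => a) Q (Config.init n V V) w → w = a := by
    rintro a w ⟨s, p, hp, hw⟩
    obtain ⟨O, hO, hret, -⟩ := hsol.restrict hT (fun _ => a)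
      (Stream'.Seq.ofStream (s ++ₛ Stream'.const p))
    obtain ⟨q, hq⟩ := hvalid _ O hO p hp w ((hret p w).2 ⟨s.length, by
      rwa [exec_ofStream, take_length_append]⟩)
    split_ifs at hq
    exact (Option.some_inj.1 hq).symm
  obtain ⟨a, b, hab⟩ := exists_pair_ne V
  -- the proposals are changed from `a` to `b` one process at a time; the output remains the same
  have hchain : ∀ s : Finset (Fin n), CanDecide alg
      (proposals (s.piecewise (fun _ => b) fun _ => a)) Q (Config.init n V V) a := by
    intro s
    induction s using Finset.induction_on with
    | empty =>
      obtain ⟨v, hv, -⟩ := (hrob fun _ => a).exists_common (s := []) (AgreeExcept.refl 0 _)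
        (inp' := proposals fun _ => a) fun _ _ => rfl
      rw [Finset.piecewise_empty]
      exact hconst a v hv ▸ hv
    | insert i s _ ih =>
      obtain ⟨v, hv, hv'⟩ := (hrob (s.piecewise (fun _ => b) fun _ => a)).exists_common (s := [])
        (AgreeExcept.refl i _)
        (inp' := proposals ((insert i s).piecewise (fun _ => b) fun _ => a)) fun p hp => by
          simp [proposals, oneShot, Finset.piecewise, hp]
      rwa [← huni _ a v ih hv] at hv'
  refine hab (hconst b a ?_)
  simpa using hchain Finset.univ

end Impossibility

/-! ### Steps of correct processes -/

section Liveness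

variable {n : ℕ} {V W : Type} {alg : Algorithm n V W} {inp : Fin n → Stream'.Seq V}
  {c : Config n V W} {ρ : Run n} {p q : Fin n}

lemma exec_succ {t : ℕ} (h : ρ.get? t = some p) :
    exec alg inp ρ (t + 1) = (exec alg inp ρ t).step alg inp p := by
  rw [exec, h]

lemma exec_succ_of_none {t : ℕ} (h : ρ.get? t = none) :
    exec alg inp ρ (t + 1) = exec alg inp ρ t := by
  rw [exec, h]

lemma exec_induction {R : Config n V W → Prop} (init : R (Config.init n V W))
    (step : ∀ c p, R c → R (c.step alg inp p)) (t : ℕ) : R (exec alg inp ρ t) := by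
  induction t with
  | zero => exact init
  | succ t ih =>
    cases h : ρ.get? t with
    | none => rwa [exec_succ_of_none h]
    | some p => exact exec_succ h ▸ step _ p ih

lemma Config.step_mem_of_ne (h : q ≠ p) : (c.step alg inp q).mem p = c.mem p := by
  cases hq : c.updateNext q <;> simp [step_update, step_snapshot, hq, h.symm]

lemma Config.step_snap_of_ne (h : q ≠ p) : (c.step alg inp q).snap p = c.snap p := by
  cases hq : c.updateNext q <;> simp [step_update, step_snapshot, hq, h.symm]

lemma Config.step_out_of_ne (h : q ≠ p) : (c.step alg inp q).out p = c.out p := by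
  cases hq : c.updateNext q <;> simp [step_update, step_snapshot, hq, h.symm]

lemma Config.step_updateNext_of_ne (h : q ≠ p) :
    (c.step alg inp q).updateNext p = c.updateNext p := by
  cases hq : c.updateNext q <;> simp [step_update, step_snapshot, hq, h.symm]

lemma Config.step_updateNext_self : (c.step alg inp p).updateNext p = !c.updateNext p := by
  cases hp : c.updateNext p <;> simp [step_update, step_snapshot, hp]

/-- A correct process performs infinitely many operations of each kind. -/
lemma exists_step_of_correct (alg : Algorithm n V W) (inp : Fin n → Stream'.Seq V)
    (hp : p ∈ ρ.correct) (b : Bool) (T : ℕ) :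
    ∃ t, T ≤ t ∧ ρ.get? t = some p ∧ (exec alg inp ρ t).updateNext p = b := by
  by_contra! hno
  rw [mem_correct] at hp
  obtain ⟨t₁, hT, ht₁⟩ := hp T
  have hb : ∀ t, t₁ + 1 ≤ t → (exec alg inp ρ t).updateNext p = b := by
    intro t ht
    induction t, ht using Nat.le_induction with
    | base =>
      rw [exec_succ ht₁, Config.step_updateNext_self]
      have := hno t₁ hT ht₁
      revert this
      cases (exec alg inp ρ t₁).updateNext p <;> cases b <;> simp
    | succ t ht ih =>
      cases h : ρ.get? t with
      | none => rwa [exec_succ_of_none h]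
      | some q =>
        have hqp : q ≠ p := by
          rintro rfl
          exact hno t (by lia) h ih
        rwa [exec_succ h, Config.step_updateNext_of_ne hqp]
  obtain ⟨t₂, h₂, ht₂⟩ := hp (t₁ + 1)
  exact hno t₂ (by lia) ht₂ (hb t₂ h₂)

/-- A property that the updates (or the snapshots) of a correct process establish, and that no
step destroys, holds from some time on. -/
lemma eventually_of_correct (hp : p ∈ ρ.correct) (b : Bool) {R : Config n V W → Prop} {T : ℕ}
    (hest : ∀ t, T ≤ t → ρ.get? t = some p → (exec alg inp ρ t).updateNext p = b →
      R (exec alg inp ρ (t + 1)))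
    (hpres : ∀ t, T ≤ t → ∀ q, ρ.get? t = some q → (q = p → (exec alg inp ρ t).updateNext p ≠ b) →
      R (exec alg inp ρ t) → R (exec alg inp ρ (t + 1))) :
    ∃ T', T ≤ T' ∧ ∀ t, T' ≤ t → R (exec alg inp ρ t) := by
  obtain ⟨t₁, hT, ht₁, hb⟩ := exists_step_of_correct alg inp hp b T
  refine ⟨t₁ + 1, by lia, fun t ht => ?_⟩
  induction t, ht using Nat.le_induction with
  | base => exact hest t₁ hT ht₁ hb
  | succ t ht ih =>
    cases h : ρ.get? t with
    | none => rwa [exec_succ_of_none h]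
    | some q =>
      by_cases hq : q = p ∧ (exec alg inp ρ t).updateNext p = b
      · exact hest t (by lia) (hq.1 ▸ h) hq.2
      · exact hpres t (by lia) q h (fun h1 h2 => hq ⟨h1, h2⟩) ih

/-- The number of outputs of a process either exceeds a given bound or is eventually constant. -/
lemma eventually_length_out (alg : Algorithm n V W) (inp : Fin n → Stream'.Seq V) (ρ : Run n)
    (p : Fin n) (j : ℕ) :
    (∃ t, j < ((exec alg inp ρ t).out p).length) ∨
      ∃ m ≤ j, ∃ T, ∀ t, T ≤ t → ((exec alg inp ρ t).out p).length = m := by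
  by_cases h : ∃ t, j < ((exec alg inp ρ t).out p).length
  · exact Or.inl h
  push Not at h
  right
  have hbdd : BddAbove (Set.range fun t => ((exec alg inp ρ t).out p).length) :=
    ⟨j, by rintro _ ⟨t, rfl⟩; exact h t⟩
  obtain ⟨T, hT⟩ := Nat.sSup_mem (Set.range_nonempty _) hbdd
  refine ⟨_, h T, T, fun t ht => le_antisymm ?_ (exec_out_prefix ρ p ht).length_le⟩
  exact (le_csSup hbdd ⟨t, rfl⟩).trans hT.ge

/-- While its number of outputs remains equal to `m`, the register of a correct process holds its
first `m + 1` inputs. -/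
lemma eventually_mem (hp : p ∈ ρ.correct) {m T : ℕ}
    (hT : ∀ t, T ≤ t → ((exec alg inp ρ t).out p).length = m) :
    ∃ T', T ≤ T' ∧ ∀ t, T' ≤ t → ∃ s, (exec alg inp ρ t).mem p =
      View.cell ((inp p).take (m + 1)) s := by
  refine eventually_of_correct
    (R := fun c => ∃ s, c.mem p = View.cell ((inp p).take (m + 1)) s) hp true
    (fun t ht h hu => ?_) (fun t ht q h hq hR => ?_)
  · rw [exec_succ h, Config.step_update hu, hT t ht]
    simp
  · rw [exec_succ h]
    obtain rfl | hqp := eq_or_ne q p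
    · rwa [Config.step_snapshot (by simpa using hq rfl)]
    · rwa [Config.step_mem_of_ne hqp]

/-- While its number of outputs remains equal to `m`, the register of a correct process and the
latest snapshot recorded there both hold its first `m + 1` inputs. -/
lemma eventually_mem_snap (hp : p ∈ ρ.correct) {m T : ℕ}
    (hT : ∀ t, T ≤ t → ((exec alg inp ρ t).out p).length = m) :
    ∃ T', ∀ t, T' ≤ t → ∃ s s', (exec alg inp ρ t).mem p =
      View.cell ((inp p).take (m + 1)) s ∧ s p = View.cell ((inp p).take (m + 1)) s' := by
  obtain ⟨T₁, hT₁, h₁⟩ := eventually_mem hp hT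
  obtain ⟨T₂, hT₂, h₂⟩ : ∃ T', T₁ ≤ T' ∧ ∀ t, T' ≤ t → ∃ s, (exec alg inp ρ t).snap p p =
      View.cell ((inp p).take (m + 1)) s := by
    refine eventually_of_correct (R := fun c => ∃ s,
      c.snap p p = View.cell ((inp p).take (m + 1)) s) hp false
      (fun t ht h hu => ?_) (fun t ht q h hq hR => ?_)
    · rw [exec_succ h, Config.step_snapshot hu]
      simpa using h₁ t ht
    · rw [exec_succ h]
      obtain rfl | hqp := eq_or_ne q p
      · rwa [Config.step_update (by simpa using hq rfl)]
      · rwa [Config.step_snap_of_ne hqp]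
  obtain ⟨T₃, -, h₃⟩ : ∃ T', T₂ ≤ T' ∧ ∀ t, T' ≤ t → ∃ s s', (exec alg inp ρ t).mem p =
      View.cell ((inp p).take (m + 1)) s ∧ s p = View.cell ((inp p).take (m + 1)) s' := by
    refine eventually_of_correct (R := fun c => ∃ s s', c.mem p =
      View.cell ((inp p).take (m + 1)) s ∧ s p = View.cell ((inp p).take (m + 1)) s') hp true
      (fun t ht h hu => ?_) (fun t ht q h hq hR => ?_)
    · obtain ⟨s', hs'⟩ := h₂ t ht
      rw [exec_succ h, Config.step_update hu, hT t (by lia)]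
      exact ⟨_, s', Function.update_self .., hs'⟩
    · rw [exec_succ h]
      obtain rfl | hqp := eq_or_ne q p
      · rwa [Config.step_snapshot (by simpa using hq rfl)]
      · rwa [Config.step_mem_of_ne hqp]
  exact ⟨T₃, h₃⟩

/-- A correct process returns if the decision rule, applied to a snapshot with its current inputs,
eventually produces an output. -/
lemma exists_returns (hp : p ∈ ρ.correct) {j : ℕ} {v : V} (hj : (inp p).get? j = some v)
    (hready : ∀ m x, (inp p).get? m = some x → ∃ T, ∀ t, T ≤ t → ∀ s,
      (exec alg inp ρ t).mem p = View.cell ((inp p).take (m + 1)) s →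
        alg p (exec alg inp ρ t).mem ≠ none) :
    ∃ w, Returns alg inp ρ p j w := by
  obtain ⟨t, ht⟩ | ⟨m, hmj, T, hT⟩ := eventually_length_out alg inp ρ p j
  · exact ⟨_, t, List.getElem?_eq_getElem ht⟩
  exfalso
  obtain ⟨x, hx⟩ := (inp p).ge_stable hmj hj
  obtain ⟨T₁, hT₁, h₁⟩ := eventually_mem hp hT
  obtain ⟨T₂, h₂⟩ := hready m x hx
  obtain ⟨t, ht, hstep, hu⟩ := exists_step_of_correct alg inp hp false (max T₁ T₂)
  rw [max_le_iff] at ht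
  obtain ⟨s, hs⟩ := h₁ t ht.1
  obtain ⟨w, hw⟩ := Option.ne_none_iff_exists'.1 (h₂ t ht.2 s hs)
  have hlen := hT t (by lia)
  have := hT (t + 1) (by lia)
  rw [exec_succ hstep, Config.step_snapshot hu] at this
  simp [hlen, hx, hw] at this

end Liveness

/-! ### Prefixes of input sequences -/

section Take

variable {α : Type} {s : Stream'.Seq α} {k : ℕ} {v : α}

lemma length_take_succ (h : s.get? k = some v) : (s.take (k + 1)).length = k + 1 := by
  refine le_antisymm Stream'.Seq.length_take_le ?_
  have : (s.take (k + 1))[k]? = some v := by simpa using h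
  exact (List.getElem?_eq_some_iff.1 this).1

lemma getLast?_take_succ (h : s.get? k = some v) : (s.take (k + 1)).getLast? = some v := by
  rw [List.getLast?_eq_getElem?, length_take_succ h]
  simpa using h

lemma get?_length_take (h : (s.take k).length < k) : s.get? (s.take k).length = none := by
  have : (s.take k)[(s.take k).length]? = none := by simp
  rwa [Stream'.Seq.getElem?_take, if_pos h] at this

lemma length_take_le_of_get?_eq_none (h : s.get? k = none) (m : ℕ) : (s.take m).length ≤ k := by
  by_contra! hlt
  have h1 := List.getElem?_eq_getElem hlt
  rw [Stream'.Seq.getElem?_take, h] at h1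
  split_ifs at h1

end Take

/-! ### Agreement with a leader -/

section Leader

variable {V : Type}

/-- What a follower with the inputs `l` reads off the register of the leader `1`: the leader's
proposal for the current instance; or, if the leader has no such proposal and never will, the
follower's own proposal. The latter is the case when the leader has written no more inputs than its
latest snapshot contains, since it has returned from all of these at that snapshot. -/
def followLeader (l : List V) : View 3 V → Option V
  | View.bot => none
  | View.cell l₁ s =>
    match l₁[l.length - 1]? with
    | some v => some v
    | none =>
      match s 1 with
      | View.bot => none
      | View.cell l₁' _ => if l₁'.length = l₁.length then l.getLast? else none

/-- Process `0` returns its own proposals, process `1` is a leader that does the same, and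
process `2` follows the leader. Processes outside `D` never return. -/
def leaderAlg (D : Finset (Fin 3)) : Algorithm 3 V V := fun p m =>
  if p ∈ D then
    match m p with
    | View.bot => none
    | View.cell l _ => if p = 2 then followLeader l (m 1) else l.getLast?
  else none

/-- The value returned in instance `j` by the leader and its follower. -/
def leaderValue (inp : Fin 3 → Stream'.Seq V) (j : ℕ) : Option V :=
  ((inp 1).get? j).or ((inp 2).get? j)

variable {D : Finset (Fin 3)} {inp : Fin 3 → Stream'.Seq V} {c : Config 3 V V} {ρ : Run 3}
  {p q : Fin 3} {j : ℕ} {v : V}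

lemma leaderAlg_eq_of_ne {m : Fin 3 → View 3 V} {k : ℕ} {s : Fin 3 → View 3 V} (hpD : p ∈ D)
    (hp : p ≠ 2) (hv : (inp p).get? k = some v)
    (hm : m p = View.cell ((inp p).take (k + 1)) s) : leaderAlg D p m = some v := by
  simp only [leaderAlg, if_pos hpD, hm, if_neg hp, getLast?_take_succ hv]

/-- `v` is a value that process `p` may return in instance `j`, when the leader has returned from
`k` instances. -/
def IsLeaderOutput (inp : Fin 3 → Stream'.Seq V) (k : ℕ) (p : Fin 3) (j : ℕ) (v : V) : Prop :=
  (p ≠ 2 ∧ (inp p).get? j = some v) ∨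
    (p = 2 ∧ (((inp 1).get? j = some v ∧ j ≤ k) ∨
      ((inp 1).get? j = none ∧ (inp 2).get? j = some v)))

lemma IsLeaderOutput.mono {k k' : ℕ} (h : IsLeaderOutput inp k p j v) (hk : k ≤ k') :
    IsLeaderOutput inp k' p j v := by
  unfold IsLeaderOutput at *
  grind

/-- An invariant of the executions of `leaderAlg`. Between an update and the next snapshot, a
register holds all inputs received so far (`pending`). The leader's register holds no more than one
input beyond those that it has returned from (`mem`), and no fewer than these (`covers`), while its
latest snapshot contains only inputs that it has returned from (`snap`); so if the two coincide,
then the leader has no further input (`exhausted`). -/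
structure LeaderInv (D : Finset (Fin 3)) (inp : Fin 3 → Stream'.Seq V) (c : Config 3 V V) :
    Prop where
  pending : ∀ p, c.updateNext p = false →
    c.mem p = View.cell ((inp p).take ((c.out p).length + 1)) (c.snap p)
  mem : ∀ l s, c.mem 1 = View.cell l s → ∃ k ≤ (c.out 1).length, l = (inp 1).take (k + 1)
  covers : ∀ m < (c.out 1).length, ∃ l s v, c.mem 1 = View.cell l s ∧ l[m]? = some v
  snap : 1 ∈ D → ∀ l s, c.snap 1 1 = View.cell l s → l.length ≤ (c.out 1).length
  exhausted : 1 ∈ D → ∀ l s l' s', c.mem 1 = View.cell l s → s 1 = View.cell l' s' →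
    l'.length = l.length → (inp 1).get? l.length = none
  out : ∀ p j v, (c.out p)[j]? = some v → p ∈ D ∧ IsLeaderOutput inp (c.out 1).length p j v

lemma LeaderInv.init : LeaderInv D inp (Config.init 3 V V) := by
  constructor <;> simp [Config.init]

/-- The output produced by a snapshot. -/
lemma LeaderInv.isLeaderOutput (hD : 2 ∈ D → 1 ∈ D) (h : LeaderInv D inp c)
    (hp : c.updateNext p = false) {x : V} (hx : (inp p).get? (c.out p).length = some x)
    (hv : leaderAlg D p c.mem = some v) :
    p ∈ D ∧ IsLeaderOutput inp (c.out 1).length p (c.out p).length v := by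
  have hpD : p ∈ D := by
    by_contra hpD
    simp [leaderAlg, hpD] at hv
  refine ⟨hpD, ?_⟩
  have hmem := h.pending p hp
  by_cases hp2 : p = 2
  · subst hp2
    refine Or.inr ⟨rfl, ?_⟩
    simp only [leaderAlg, if_pos hpD, hmem, if_true] at hv
    cases hm1 : c.mem 1 with
    | bot => simp [hm1, followLeader] at hv
    | cell l s =>
      obtain ⟨k, hk, hl⟩ := h.mem l s hm1
      simp only [hm1, followLeader, length_take_succ hx, Nat.add_sub_cancel,
        getLast?_take_succ hx] at hv
      cases hlj : l[(c.out 2).length]? with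
      | some y =>
        simp only [hlj, Option.some.injEq] at hv
        subst hv
        left
        rw [hl, Stream'.Seq.getElem?_take] at hlj
        split_ifs at hlj with hlt
        exact ⟨hlj, by lia⟩
      | none =>
        right
        simp only [hlj] at hv
        cases hs1 : s 1 with
        | bot => simp [hs1] at hv
        | cell l' s' =>
          simp only [hs1] at hv
          split_ifs at hv with hlen
          have hnone := h.exhausted (hD hpD) l s l' s' hm1 hs1 hlen
          exact ⟨(inp 1).le_stable (List.getElem?_eq_none_iff.1 hlj) hnone, by rw [hx, hv]⟩
  · rw [leaderAlg_eq_of_ne hpD hp2 hx hmem] at hv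
    exact Or.inl ⟨hp2, by rw [hx, hv]⟩

lemma LeaderInv.step_update (h : LeaderInv D inp c) (hp : c.updateNext p = true) :
    LeaderInv D inp (c.step (leaderAlg D) inp p) := by
  rw [Config.step_update hp]
  refine ⟨fun q hq => ?_, fun l s hl => ?_, fun m hm => ?_, h.snap,
    fun h1 l s l' s' hl hs hlen => ?_, h.out⟩
  · obtain rfl | hqp := eq_or_ne q p
    · simp
    · simpa [hqp] using h.pending q (by simpa [hqp] using hq)
  · obtain rfl | hp1 := eq_or_ne 1 p
    · simp only [Function.update_self, View.cell.injEq] at hl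
      exact ⟨_, le_rfl, hl.1.symm⟩
    · exact h.mem l s (by simpa [hp1] using hl)
  · obtain rfl | hp1 := eq_or_ne 1 p
    · obtain ⟨-, ⟨-, hv⟩ | ⟨h12, -⟩⟩ := h.out 1 m _ (List.getElem?_eq_getElem hm)
      · refine ⟨(inp 1).take ((c.out 1).length + 1), c.snap 1, (c.out 1)[m], by simp, ?_⟩
        rw [Stream'.Seq.getElem?_take, if_pos (Nat.lt_succ_of_lt hm), hv]
      · exact absurd h12 (by decide)
    · simpa [hp1] using h.covers m hm
  · obtain rfl | hp1 := eq_or_ne 1 p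
    · simp only [Function.update_self, View.cell.injEq] at hl
      obtain ⟨rfl, rfl⟩ := hl
      have := h.snap h1 l' s' hs
      exact get?_length_take (by lia)
    · exact h.exhausted h1 l s l' s' (by simpa [hp1] using hl) hs hlen

lemma LeaderInv.step_snapshot (hD : 2 ∈ D → 1 ∈ D) (h : LeaderInv D inp c)
    (hp : c.updateNext p = false) : LeaderInv D inp (c.step (leaderAlg D) inp p) := by
  have hmono : (c.out 1).length ≤ ((c.step (leaderAlg D) inp p).out 1).length :=
    (Config.out_prefix_step p 1).length_le
  have hmem : (c.step (leaderAlg D) inp p).mem = c.mem := by rw [Config.step_snapshot hp]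
  have hcases : (c.step (leaderAlg D) inp p).out p = c.out p ∨
      ∃ x v, (inp p).get? (c.out p).length = some x ∧ leaderAlg D p c.mem = some v ∧
        (c.step (leaderAlg D) inp p).out p = c.out p ++ [v] := by
    rw [Config.step_snapshot hp]
    cases (inp p).get? (c.out p).length <;> cases leaderAlg D p c.mem <;> simp
  have hout : ∀ q ≠ p, (c.step (leaderAlg D) inp p).out q = c.out q := fun q hq =>
    Config.step_out_of_ne hq.symm
  refine ⟨fun q hq => ?_, fun l s hl => ?_, fun m hm => ?_, fun h1 l s hl => ?_, ?_,
    fun q j v hv => ?_⟩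
  · obtain rfl | hqp := eq_or_ne q p
    · rw [Config.step_updateNext_self, hp] at hq
      exact absurd hq (by simp)
    · rw [Config.step_updateNext_of_ne hqp.symm] at hq
      rw [hmem, hout q hqp, Config.step_snap_of_ne hqp.symm]
      exact h.pending q hq
  · obtain ⟨k, hk, hl⟩ := h.mem l s (hmem ▸ hl)
    exact ⟨k, hk.trans hmono, hl⟩
  · rw [hmem]
    rcases lt_or_ge m (c.out 1).length with hlt | hge
    · exact h.covers m hlt
    · obtain rfl | hp1 := eq_or_ne 1 p
      · obtain heq | ⟨x, v, hx, -, heq⟩ := hcases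
        · rw [heq] at hm
          lia
        · rw [heq, List.length_append, List.length_singleton] at hm
          obtain rfl : m = (c.out 1).length := by lia
          exact ⟨_, _, x, h.pending 1 hp, by simpa using hx⟩
      · rw [hout 1 hp1] at hm
        lia
  · obtain rfl | hp1 := eq_or_ne 1 p
    · rw [Config.step_snapshot hp] at hl
      simp only [Function.update_self] at hl
      obtain ⟨rfl, -⟩ := View.cell.inj ((h.pending 1 hp).symm.trans hl)
      cases hx : (inp 1).get? (c.out 1).length with
      | none => exact (length_take_le_of_get?_eq_none hx _).trans hmono
      | some x =>
        have hal := leaderAlg_eq_of_ne h1 (by decide) hx (h.pending 1 hp)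
        rw [Config.step_snapshot hp]
        simpa [hx, hal] using Stream'.Seq.length_take_le
    · rw [hout 1 hp1]
      rw [Config.step_snap_of_ne hp1.symm] at hl
      exact h.snap h1 l s hl
  · rw [hmem]
    exact h.exhausted
  · obtain rfl | hqp := eq_or_ne q p
    · obtain heq | ⟨x, w, hx, hw, heq⟩ := hcases
      · rw [heq] at hv
        exact (h.out q j v hv).imp_right fun h => h.mono hmono
      · rw [heq, List.getElem?_append] at hv
        split_ifs at hv with hlt
        · exact (h.out q j v hv).imp_right fun h => h.mono hmono
        · obtain ⟨hj, rfl⟩ : j - (c.out q).length = 0 ∧ w = v := by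
            rw [List.getElem?_singleton] at hv
            split_ifs at hv with h0
            exact ⟨h0, by simpa using hv⟩
          obtain rfl : j = (c.out q).length := by lia
          exact (h.isLeaderOutput hD hp hx hw).imp_right fun h => h.mono hmono
    · rw [hout q hqp] at hv
      exact (h.out q j v hv).imp_right fun h => h.mono hmono

lemma leaderInv_exec (hD : 2 ∈ D → 1 ∈ D) (inp : Fin 3 → Stream'.Seq V) (ρ : Run 3) (t : ℕ) :
    LeaderInv D inp (exec (leaderAlg D) inp ρ t) := by
  refine exec_induction LeaderInv.init (fun c p h => ?_) t
  cases hp : c.updateNext p with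
  | true => exact h.step_update hp
  | false => exact h.step_snapshot hD hp

/-- The values returned are proposals made to the same instance, and any two processes other
than `0` return the same value. -/
lemma leaderAlg_safe (hD : 2 ∈ D → 1 ∈ D) (h : Returns (leaderAlg D) inp ρ p j v) :
    p ∈ D ∧ (if p = 0 then (inp 0).get? j else leaderValue inp j) = some v ∧
      ∃ q, (q = 0 ↔ p = 0) ∧ Invokes (leaderAlg D) inp ρ q j v := by
  obtain ⟨t, ht⟩ := h
  have hinv : ∀ q, (inp q).get? j = some v →
      j ≤ ((exec (leaderAlg D) inp ρ t).out q).length → Invokes (leaderAlg D) inp ρ q j v :=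
    fun q hq hj => ⟨hq, fun i hi => ⟨_, t, List.getElem?_eq_getElem (hi.trans_le hj)⟩⟩
  have hlen : j ≤ ((exec (leaderAlg D) inp ρ t).out p).length :=
    (List.getElem?_eq_some_iff.1 ht).1.le
  obtain ⟨hpD, ⟨hp2, hv⟩ | ⟨rfl, ⟨hv, hj⟩ | ⟨hnone, hv⟩⟩⟩ :=
    (leaderInv_exec hD inp ρ t).out p j v ht
  · refine ⟨hpD, ?_, p, Iff.rfl, hinv p hv hlen⟩
    split_ifs with hp0
    · rw [← hp0, hv]
    · obtain rfl : p = 1 := by lia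
      simp [leaderValue, hv]
  · exact ⟨hpD, by simp [leaderValue, hv], 1, by decide, hinv 1 hv hj⟩
  · exact ⟨hpD, by simp [leaderValue, hv, hnone], 2, by decide, hinv 2 hv hlen⟩

/-- A correct process in `D` returns from all its instances, provided that the leader is correct in
case the process is a follower. -/
lemma leaderAlg_live (hD : 2 ∈ D → 1 ∈ D) (hp : p ∈ ρ.correct) (hpD : p ∈ D)
    (h1 : p = 2 → 1 ∈ ρ.correct) (hj : (inp p).get? j = some v) :
    ∃ w, Returns (leaderAlg D) inp ρ p j w := by
  refine exists_returns hp hj fun m x hx => ?_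
  by_cases hp2 : p = 2
  · subst hp2
    obtain ⟨T, hT⟩ | ⟨k, hkm, T, hT⟩ := eventually_length_out (leaderAlg D) inp ρ 1 m
    · refine ⟨T, fun t ht s hs => ?_⟩
      obtain ⟨l, s', y, hl, hy⟩ := (leaderInv_exec hD inp ρ t).covers m
        (hT.trans_le (exec_out_prefix ρ 1 ht).length_le)
      simp [leaderAlg, hpD, hs, hl, followLeader, length_take_succ hx, hy]
    · obtain ⟨T', hT'⟩ := eventually_mem_snap (h1 rfl) hT
      refine ⟨T', fun t ht s hs => ?_⟩
      obtain ⟨s₁, s₂, hm, hs₁⟩ := hT' t ht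
      simp only [leaderAlg, if_pos hpD, hs, if_true, hm, followLeader, length_take_succ hx, hs₁,
        getLast?_take_succ hx]
      split <;> simp
  · refine ⟨0, fun t _ s hs => ?_⟩
    rw [leaderAlg_eq_of_ne hpD hp2 hx hs]
    simp

/-- The follower and the leader count for one, and so does process `0`. -/
lemma leaderAlg_solvesIterative (hD : 2 ∈ D → 1 ∈ D) {M : Model 3}
    (hM : ∀ ρ ∈ M, ∀ p ∈ ρ.correct, p ∈ D ∧ (p = 2 → 1 ∈ ρ.correct)) :
    SolvesIterative (leaderAlg D : Algorithm 3 V V) (D.image fun p => decide (p = 0)).card M := by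
  refine fun inp ρ _ => ⟨fun j => ⟨?_, ?_⟩, fun hρ p hp j v hj => ?_⟩
  · rintro v ⟨p, hp⟩
    obtain ⟨-, -, q, -, hq⟩ := leaderAlg_safe hD hp
    exact ⟨q, hq⟩
  · classical
    let f : Bool → Option V := fun b => if b then (inp 0).get? j else leaderValue inp j
    have hsub : some '' {v | ∃ p, Returns (leaderAlg D) inp ρ p j v} ⊆
        (((D.image fun p => decide (p = 0)).image f : Finset (Option V)) : Set (Option V)) := by
      rintro _ ⟨v, ⟨p, hp⟩, rfl⟩
      obtain ⟨hpD, hv, -⟩ := leaderAlg_safe hD hp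
      rw [Finset.mem_coe, Finset.image_image, Finset.mem_image]
      exact ⟨p, hpD, by simpa [f] using hv⟩
    rw [← (Option.some_injective V).encard_image]
    refine (Set.encard_le_encard hsub).trans ?_
    rw [Set.encard_coe_eq_coe_finsetCard]
    exact_mod_cast Finset.card_image_le
  · exact leaderAlg_live hD hp (hM ρ hρ p hp).1 (hM ρ hρ p hp).2 hj

end Leader

/-! ### Relations between tasks and between models -/

section Tasks

variable {n : ℕ} {V W : Type} {M M' : Model n}

lemma Solvable.mono {T : DistTask n V W} (hM : M ⊆ M') (h : Solvable T M') : Solvable T M := by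
  obtain ⟨alg, halg⟩ := h
  refine ⟨alg, fun I hI ρ hρ => ?_⟩
  obtain ⟨O, hO, hret, hdec⟩ := halg I hI ρ hρ
  exact ⟨O, hO, hret, fun h => hdec (hM h)⟩

lemma exists_output (alg : Algorithm n V W) (inp : Fin n → Stream'.Seq V) (ρ : Run n) (j : ℕ) :
    ∃ O : Fin n → Option W, ∀ p w, O p = some w ↔ Returns alg inp ρ p j w := by
  classical
  refine ⟨fun p => if h : ∃ w, Returns alg inp ρ p j w then some h.choose else none,
    fun p w => ⟨fun h => ?_, fun h => ?_⟩⟩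
  · beta_reduce at h
    split_ifs at h with hw
    exact Option.some_inj.1 h ▸ hw.choose_spec
  · have hw : ∃ w, Returns alg inp ρ p j w := ⟨w, h⟩
    beta_reduce
    rw [dif_pos hw, hw.choose_spec.unique h]

lemma oneShot_get?_zero (I : Fin n → Option V) (p : Fin n) : (oneShot I p).get? 0 = I p := by
  cases h : I p <;> simp [oneShot, h]

lemma setConsensus_solvable_mono {k k' : ℕ} (hk : k ≤ k')
    (h : Solvable (setConsensus n V k) M) : Solvable (setConsensus n V k') M := by
  obtain ⟨alg, halg⟩ := h
  refine ⟨alg, fun I hI ρ hρ => ?_⟩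
  obtain ⟨O, hO, hO'⟩ := halg I hI ρ hρ
  exact ⟨O, ⟨hO.1, hO.2.trans (by exact_mod_cast hk)⟩, hO'⟩

/-- A task is the special case of a single instance. -/
lemma SolvesIterative.solvable {alg : Algorithm n V V} {k : ℕ} (h : SolvesIterative alg k M) :
    Solvable (setConsensus n V k) M := by
  refine ⟨alg, fun I _ ρ hρ => ?_⟩
  obtain ⟨O, hO⟩ := exists_output alg (oneShot I) ρ 0
  obtain ⟨hsafe, hlive⟩ := h (oneShot I) ρ fun p => by
    rw [hρ, ne_eq, ne_eq, ← Stream'.Seq.get?_zero_eq_none, oneShot_get?_zero]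
  have hset : {v | ∃ p, O p = some v} = {v | ∃ p, Returns alg (oneShot I) ρ p 0 v} := by
    simp only [hO]
  refine ⟨O, ⟨?_, hset ▸ (hsafe 0).2⟩, hO, fun hM p hp => ?_⟩
  · rw [hset]
    refine (hsafe 0).1.trans ?_
    rintro v ⟨q, hq, -⟩
    exact ⟨q, by rwa [oneShot_get?_zero] at hq⟩
  · obtain ⟨v, hv⟩ := Option.ne_none_iff_exists'.1
      ((hρ p).1 (correct_subset_participating ρ hp))
    obtain ⟨w, hw⟩ := hlive hM p hp 0 v (by rw [oneShot_get?_zero, hv])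
    simp [(hO p w).2 hw]

/-- `0`-set consensus is unsolvable as soon as somebody has to decide. -/
lemma not_solvable_setConsensus_zero [Nonempty V] {ρ : Run n} (hρ : ρ ∈ M)
    (hcor : ρ.correct.Nonempty) :
    ¬ Solvable (setConsensus n V 0) M := by
  classical
  rintro ⟨alg, halg⟩
  obtain ⟨p, hp⟩ := hcor
  obtain ⟨O, hO, -, hdec⟩ := halg
    (fun p => if p ∈ ρ.participating then some (Classical.arbitrary V) else none)
    (Set.mem_univ _) ρ (fun p => by simp)
  obtain ⟨v, hv⟩ := Option.ne_none_iff_exists'.1 (hdec hρ p hp)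
  have := hO.2
  simp only [Nat.cast_zero, nonpos_iff_eq_zero, Set.encard_eq_zero] at this
  exact Set.eq_empty_iff_forall_notMem.1 this v ⟨p, hv⟩

lemma not_solvable_consensus [NeZero n] [Nontrivial V]
    (hcrash : ∀ x, ∃ S : Finset (Fin n), x ∉ S ∧ S.Nonempty ∧
      ∀ ρ : Run n, ρ.IsInfinite → ρ.correct = S → ρ ∈ M)
    (hall : ∀ ρ : Run n, ρ.IsInfinite → ρ.correct = Finset.univ → ρ ∈ M) :
    ¬ Solvable (setConsensus n V 1) M := by
  refine not_solvable_of_crash (Q := Finset.univ) rfl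
    (fun I O hO p _ q _ v w hv hw => ?_) (fun I O hO p _ w hw => hO.1 ⟨p, hw⟩)
    (fun x => ?_) hall
  · exact Set.encard_le_one_iff.1 hO.2 v w ⟨p, hv⟩ ⟨q, hw⟩
  · obtain ⟨S, hxS, ⟨p, hp⟩, hM⟩ := hcrash x
    exact ⟨S, hxS, ⟨p, Finset.mem_univ p, hp⟩, hM⟩

end Tasks

/-! ### The set consensus power of the example -/

section Setcon

variable {n : ℕ} {A : Adversary n}

lemma setcon_le {k : ℕ}
    (h : ∀ S ∈ A, ∃ a ∈ S, (A.restrict (S \ {a})).setcon ≤ k) : A.setcon ≤ k + 1 := by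
  rw [Adversary.setcon]
  refine Finset.sup_le fun S _ => Nat.succ_le_succ ?_
  obtain ⟨a, ha, hk⟩ := h S.1 S.2
  exact (ciInf_le (OrderBot.bddBelow _) (⟨a, ha⟩ : {a // a ∈ S.1})).trans hk

lemma le_setcon {k : ℕ} {S : Finset (Fin n)} (hS : S ∈ A) (hne : S.Nonempty)
    (h : ∀ a ∈ S, k ≤ (A.restrict (S \ {a})).setcon) : k + 1 ≤ A.setcon := by
  rw [Adversary.setcon]
  have : Nonempty {a // a ∈ S} := hne.to_subtype
  exact (Nat.succ_le_succ (le_ciInf fun a : {a // a ∈ S} => h a.1 a.2)).trans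
    (Finset.le_sup (f := fun S : {S // S ∈ A} =>
      (⨅ a : {a // a ∈ S.1}, (A.restrict (S.1 \ {a.1})).setcon) + 1) (Finset.mem_attach A ⟨S, hS⟩))

lemma setcon_empty : (∅ : Adversary n).setcon = 0 := by
  rw [Adversary.setcon]
  rfl

lemma setcon_eq_one (hA : A.Nonempty) (h : ∀ S ∈ A, ∃ a ∈ S, A.restrict (S \ {a}) = ∅) :
    A.setcon = 1 := by
  refine le_antisymm (setcon_le fun S hS => ?_) ?_
  · obtain ⟨a, ha, he⟩ := h S hS
    exact ⟨a, ha, by rw [he, setcon_empty]⟩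
  · obtain ⟨S, hS⟩ := hA
    obtain ⟨a, ha, -⟩ := h S hS
    exact le_setcon hS ⟨a, ha⟩ fun _ _ => Nat.zero_le _

lemma setcon_exampleAdversary : exampleAdversary.setcon = 2 := by
  have h0 : ∀ P : Finset (Fin 3), exampleAdversary.restrict P = {{0}} ∨
      exampleAdversary.restrict P = {{1, 2}} → (exampleAdversary.restrict P).setcon = 1 := by
    rintro P (h | h) <;> rw [h] <;> exact setcon_eq_one (by decide) (by decide)
  refine le_antisymm (setcon_le fun S hS => ?_)
    (le_setcon (S := {0, 1, 2}) (by decide) (by decide) fun a _ => ?_)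
  · have : ∃ a ∈ S, exampleAdversary.restrict (S \ {a}) = ∅ ∨
        exampleAdversary.restrict (S \ {a}) = {{0}} := by
      revert S
      decide
    obtain ⟨a, ha, h | h⟩ := this
    · exact ⟨a, ha, by rw [h, setcon_empty]; exact Nat.zero_le _⟩
    · exact ⟨a, ha, (h0 _ (Or.inl h)).le⟩
  · refine (h0 _ ?_).ge
    revert a
    decide

lemma setcon_restrictMeet_exampleAdversary :
    (exampleAdversary.restrictMeet Finset.univ {1, 2}).setcon = 1 :=
  setcon_eq_one (by decide) (by decide)

lemma not_isFair_exampleAdversary : ¬ exampleAdversary.IsFair := by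
  intro h
  have := h Finset.univ {1, 2} (Finset.subset_univ _)
  rw [setcon_restrictMeet_exampleAdversary,
    show exampleAdversary.restrict Finset.univ = exampleAdversary by decide,
    setcon_exampleAdversary] at this
  exact absurd this (by decide)

lemma exampleAlpha_eq (P : Finset (Fin 3)) : exampleAlpha P =
    if P = ∅ ∨ P = {1} ∨ P = {2} then 0 else if P = Finset.univ then 2 else 1 := by
  have h : exampleAdversary.restrict P = if P = ∅ ∨ P = {1} ∨ P = {2} then ∅
      else if P = Finset.univ then exampleAdversary
      else if P = {1, 2} then {{1, 2}} else {{0}} := by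
    revert P
    decide
  rw [exampleAlpha, h]
  split_ifs
  · exact setcon_empty
  · exact setcon_exampleAdversary
  · exact setcon_eq_one (by decide) (by decide)
  · exact setcon_eq_one (by decide) (by decide)

end Setcon

/-! ### The agreement function of the example -/

section Example

variable {V : Type}

lemma exists_run_exampleAdversary_iff (P : Finset (Fin 3)) :
    (∃ ρ ∈ exampleAdversary.model, ρ.IsInfinite ∧ ρ.participating = P) ↔
      ¬ (P = ∅ ∨ P = {1} ∨ P = {2}) := by
  have h : (∃ S ∈ exampleAdversary, S.Nonempty ∧ S ⊆ P) ↔ ¬ (P = ∅ ∨ P = {1} ∨ P = {2}) := by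
    revert P
    decide
  have hne : ∀ S ∈ exampleAdversary, S.Nonempty := by decide
  rw [← h]
  constructor
  · rintro ⟨ρ, hρ, -, rfl⟩
    exact ⟨_, hρ.2, hne _ hρ.2, correct_subset_participating ρ⟩
  · rintro ⟨S, hS, hne, hSP⟩
    obtain ⟨ρ, hinf, hcor, hpart⟩ := exists_infinite_run hne hSP
    exact ⟨ρ, ⟨hinf, hcor ▸ hS⟩, hinf, hpart⟩

lemma exists_solvesIterative_exampleAlpha {P : Finset (Fin 3)}
    (hP : ¬ (P = ∅ ∨ P = {1} ∨ P = {2})) :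
    ∃ alg : Algorithm 3 V V,
      SolvesIterative alg (exampleAlpha P) (exampleAdversary.model.restrict P) := by
  -- the processes that may return: if `{0}` is the only live set, process `0` alone does
  let D : Finset (Fin 3) → Finset (Fin 3) := fun P =>
    if P = Finset.univ then Finset.univ else if P = {1, 2} then {1, 2} else {0}
  have hD : 2 ∈ D P → 1 ∈ D P := by
    clear hP
    revert P
    decide
  have hlive : ∀ S ∈ exampleAdversary, S ⊆ P → ∀ p ∈ S, p ∈ D P ∧ (p = 2 → 1 ∈ S) := by
    clear hD
    revert P
    decide
  have hcard : exampleAlpha P = ((D P).image fun p => decide (p = 0)).card := by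
    rw [exampleAlpha_eq, if_neg hP]
    clear hlive hD hP
    revert P
    decide
  rw [hcard]
  exact ⟨leaderAlg (D P), leaderAlg_solvesIterative hD fun ρ hρ =>
    hlive _ hρ.1.2 ((correct_subset_participating ρ).trans hρ.2)⟩

lemma not_solvable_consensus_exampleAdversary [Nontrivial V] :
    ¬ Solvable (setConsensus 3 V 1) exampleAdversary.model := by
  refine not_solvable_consensus (fun x => ?_) fun ρ hinf hcor =>
    ⟨hinf, by rw [hcor]; decide⟩
  have : ∃ S ∈ exampleAdversary, x ∉ S ∧ S.Nonempty := by
    revert x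
    decide
  obtain ⟨S, hS, hxS, hne⟩ := this
  exact ⟨S, hxS, hne, fun ρ hinf hcor => ⟨hinf, hcor ▸ hS⟩⟩

lemma not_solvable_setConsensus_exampleAlpha {P : Finset (Fin 3)}
    (hP : ¬ (P = ∅ ∨ P = {1} ∨ P = {2}))
    (hV : ((exampleAlpha P - 1 : ℕ) : ℕ∞) + 1 ≤ ENat.card V) :
    ¬ Solvable (setConsensus 3 V (exampleAlpha P - 1)) (exampleAdversary.model.restrict P) := by
  rw [exampleAlpha_eq, if_neg hP] at hV ⊢
  split_ifs at hV ⊢ with hu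
  · have : Nontrivial V := by
      rw [← ENat.one_lt_card_iff_nontrivial]
      exact lt_of_lt_of_le (by norm_num) hV
    subst hu
    have hsub : exampleAdversary.model ⊆ exampleAdversary.model.restrict Finset.univ :=
      fun ρ hρ => ⟨hρ, Finset.subset_univ _⟩
    exact fun h => not_solvable_consensus_exampleAdversary (h.mono hsub)
  · have : Nonempty V := by
      rw [← ENat.one_le_card_iff_nonempty]
      simpa using hV
    obtain ⟨ρ, hρ, -, rfl⟩ := (exists_run_exampleAdversary_iff P).2 hP
    have hne : ∀ S ∈ exampleAdversary, S.Nonempty := by decide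
    exact not_solvable_setConsensus_zero ⟨hρ, subset_rfl⟩ (hne _ hρ.2)

theorem isAgreementFunction_exampleAdversary_iff (α : Finset (Fin 3) → ℕ) :
    IsAgreementFunction exampleAdversary.model α ↔ α = exampleAlpha := by
  constructor
  · intro h
    funext P
    obtain ⟨hbad, hgood⟩ := h P
    rw [exists_run_exampleAdversary_iff] at hbad hgood
    by_cases hP : P = ∅ ∨ P = {1} ∨ P = {2}
    · rw [hbad (not_not_intro hP), exampleAlpha_eq, if_pos hP]
    · -- solvability of `k`-set consensus is monotone in `k`
      obtain ⟨hsol, hunsol⟩ := hgood hP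
      by_contra hne
      rcases lt_or_gt_of_ne hne with hlt | hgt
      · obtain ⟨alg, halg⟩ := hsol ℕ (by simp)
        exact not_solvable_setConsensus_exampleAlpha (V := ℕ) hP (by simp)
          (setConsensus_solvable_mono (by lia) halg.solvable)
      · obtain ⟨alg, halg⟩ := exists_solvesIterative_exampleAlpha (V := ℕ) hP
        exact hunsol ℕ (by simp) (setConsensus_solvable_mono (by lia) halg.solvable)
  · rintro rfl P
    rw [exists_run_exampleAdversary_iff]
    refine ⟨fun hP => ?_, fun hP => ⟨fun V _ => exists_solvesIterative_exampleAlpha hP,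
      fun V hV => not_solvable_setConsensus_exampleAlpha hP hV⟩⟩
    rw [exampleAlpha_eq, if_pos (not_not.1 hP)]

/-! ### Consensus between `p₂` and `p₃` -/

theorem solvable_consensusAmong_exampleAdversary :
    Solvable (consensusAmong V ({1, 2} : Finset (Fin 3))) exampleAdversary.model := by
  have hD : 2 ∈ (Finset.univ : Finset (Fin 3)) → 1 ∈ (Finset.univ : Finset (Fin 3)) := by simp
  refine ⟨leaderAlg Finset.univ, fun I _ ρ hρ => ?_⟩
  obtain ⟨O, hO⟩ := exists_output (leaderAlg Finset.univ) (oneShot I) ρ 0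
  have hne : ∀ p ∈ ({1, 2} : Finset (Fin 3)), p ≠ 0 := by decide
  refine ⟨O, ⟨fun p hp v hv => ?_, fun p hp q hq v w hv hw => ?_⟩, hO, fun hM p hp => ?_⟩
  · obtain ⟨-, -, q, hq, hinv⟩ := leaderAlg_safe hD ((hO p v).1 hv)
    refine ⟨q, ?_, by rw [← oneShot_get?_zero I, hinv.1]⟩
    have hq0 : q ≠ 0 := fun h => hne p hp (hq.1 h)
    clear hinv hq
    revert q
    decide
  · obtain ⟨-, hv, -⟩ := leaderAlg_safe hD ((hO p v).1 hv)
    obtain ⟨-, hw, -⟩ := leaderAlg_safe hD ((hO q w).1 hw)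
    rw [if_neg (hne p hp)] at hv
    rw [if_neg (hne q hq)] at hw
    exact Option.some_inj.1 (hv.symm.trans hw)
  · obtain ⟨v, hv⟩ := Option.ne_none_iff_exists'.1
      ((hρ p).1 (correct_subset_participating ρ hp))
    have hlive : ∀ S ∈ exampleAdversary, 2 ∈ S → 1 ∈ S := by decide
    obtain ⟨w, hw⟩ := leaderAlg_live hD hp (Finset.mem_univ p)
      (fun h => hlive _ hM.2 (h ▸ hp)) ((oneShot_get?_zero I p).trans hv)
    simp [(hO p w).2 hw]

lemma not_solvable_consensus_resilient [Nontrivial V] :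
    ¬ Solvable (setConsensus 3 V 1) (resilient 3 1).model := by
  refine not_solvable_consensus (fun x => ?_) fun ρ hinf hcor =>
    ⟨hinf, by rw [hcor]; decide⟩
  have : ∃ S ∈ resilient 3 1, x ∉ S ∧ S.Nonempty := by
    revert x
    decide
  obtain ⟨S, hS, hxS, hne⟩ := this
  exact ⟨S, hxS, hne, fun ρ hinf hcor => ⟨hinf, hcor ▸ hS⟩⟩

lemma not_solvable_consensusAmong_resilient [Nontrivial V] :
    ¬ Solvable (consensusAmong V ({1, 2} : Finset (Fin 3))) (resilient 3 1).model := by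
  refine not_solvable_of_crash (Q := {1, 2}) rfl (fun I O hO => hO.2)
    (fun I O hO p hp w hw => (hO.1 p hp w hw).imp fun q => And.right) (fun x => ?_)
    fun ρ hinf hcor =>
    ⟨hinf, by rw [hcor]; decide⟩
  have : ∃ S ∈ resilient 3 1, x ∉ S ∧ ∃ p ∈ ({1, 2} : Finset (Fin 3)), p ∈ S := by
    revert x
    decide
  obtain ⟨S, hS, hxS, hne⟩ := this
  exact ⟨S, hxS, hne, fun ρ hinf hcor => ⟨hinf, hcor ▸ hS⟩⟩

/-- If only two processes participate, then both of them are correct in the `1`-resilient model. -/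
lemma resilient_subset_alphaModel : (resilient 3 1).model ⊆ alphaModel exampleAlpha := by
  have h : ∀ P S : Finset (Fin 3), S ∈ resilient 3 1 → S ⊆ P →
      1 ≤ (if P = ∅ ∨ P = {1} ∨ P = {2} then 0 else if P = Finset.univ then 2 else 1) ∧
      (P \ S).card ≤
        (if P = ∅ ∨ P = {1} ∨ P = {2} then 0 else if P = Finset.univ then 2 else 1) - 1 := by
    decide
  intro ρ hρ
  rw [alphaModel, Set.mem_ofPred_eq, exampleAlpha_eq]
  exact h _ _ hρ.2 (correct_subset_participating ρ)

lemma not_solvable_consensusAmong_alphaModel [Nontrivial V] :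
    ¬ Solvable (consensusAmong V ({1, 2} : Finset (Fin 3))) (alphaModel exampleAlpha) :=
  fun h => not_solvable_consensusAmong_resilient (h.mono resilient_subset_alphaModel)

lemma not_equivalent_alphaModel : ¬ exampleAdversary.model.Equivalent (alphaModel exampleAlpha) :=
  fun h => not_solvable_consensusAmong_alphaModel (V := Bool)
    ((h _ _ _).1 solvable_consensusAmong_exampleAdversary)

end Example

theorem mainTheorem9 :
    -- the set consensus powers of the adversary `A`, and its unfairness
    exampleAdversary.setcon = 2 ∧
    (exampleAdversary.restrictMeet Finset.univ {1, 2}).setcon = 1 ∧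
    ¬ exampleAdversary.IsFair ∧
    -- the agreement function of the `A`-model and its values
    (∀ α : Finset (Fin 3) → ℕ,
      IsAgreementFunction exampleAdversary.model α ↔ α = exampleAlpha) ∧
    (∀ P : Finset (Fin 3), exampleAlpha P =
      if P = ∅ ∨ P = {1} ∨ P = {2} then 0 else if P = Finset.univ then 2 else 1) ∧
    -- consensus between `p₂` and `p₃`, over any value set with at least two elements
    (∀ (V : Type) [Nontrivial V],
      Solvable (consensusAmong V ({1, 2} : Finset (Fin 3))) exampleAdversary.model ∧
      ¬ Solvable (consensusAmong V ({1, 2} : Finset (Fin 3))) (alphaModel exampleAlpha) ∧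
      ¬ Solvable (consensusAmong V ({1, 2} : Finset (Fin 3))) (resilient 3 1).model ∧
      ¬ Solvable (setConsensus 3 V 1) (resilient 3 1).model) ∧
    -- the `α_A`-model solves no more tasks than the `1`-resilient model
    (∀ (V W : Type) (T : DistTask 3 V W),
      Solvable T (alphaModel exampleAlpha) → Solvable T (resilient 3 1).model) ∧
    -- the `A`-model is not equivalent to the `α_A`-model
    ¬ exampleAdversary.model.Equivalent (alphaModel exampleAlpha) ∧
    ¬ exampleAdversary.model.IsCharacterizedByAgreement := by
  refine ⟨setcon_exampleAdversary, setcon_restrictMeet_exampleAdversary,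
    not_isFair_exampleAdversary, isAgreementFunction_exampleAdversary_iff, exampleAlpha_eq,
    fun V _ => ⟨solvable_consensusAmong_exampleAdversary, not_solvable_consensusAmong_alphaModel,
      not_solvable_consensusAmong_resilient, not_solvable_consensus_resilient⟩,
    fun V W T h => h.mono resilient_subset_alphaModel, not_equivalent_alphaModel, ?_⟩
  rintro ⟨α, hα, heq⟩
  rw [isAgreementFunction_exampleAdversary_iff] at hα
  exact not_equivalent_alphaModel (hα ▸ heq)
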